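/- Let "large set" mean a set in a fixed Grothendieck universe, $\mathbf{SET}$ the category of large sets, and "large category" a category whose objects and morphisms form large sets. **Metatheories, theories, metamodels.** Let $\mathcal M=(\mathcal M,I,\otimes)$ be a monoidal category (a *metatheory*), $\mathsf T=(T,e,m)$ a monoid object in $\mathcal M$ (a *theory*), and $\mathcal C$ a large category. A *metamodel* of $\mathcal M$ in $\mathcal C$ is a functor $\Phi:\mathcal M^{\mathrm{op}}\times\mathcal C^{\mathrm{op}}\times\mathcal C\to\mathbf{SET}$, $(X,A,B)\mapsto\Phi_X(A,B)$, together with elements $\phi_C\in\Phi_I(C,C)$, natural in $C$ (that is $\Phi_I(C,f)(\phi_C)=\Phi_I(f,C')(\phi_{C'})$ for $f:C\to C'$), and maps $\phi_{X,Y}:\Phi_Y(B,C)\times\Phi_X(A,B)\to\Phi_{Y\otimes X}(A,C)$, natural in $X,Y,A,C$ and dinatural in $B$, satisfying the associativity law and the two unit laws of a lax monoidal functor. Fix a metamodel $\Phi$. A *model* of $\mathsf T$ is a pair $(C,\xi)$ with $C\in\mathcal C$ and $\xi\in\Phi_T(C,C)$ such that $\Phi_e(\xi)=\phi_C$ and $\Phi_m(\xi)=\phi_{T,T}(\xi,\xi)$.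 A homomorphism $(C,\xi)\to(C',\xi')$ is a morphism $f:C\to C'$ with $\Phi_T(C,f)(\xi)=\Phi_T(f,C')(\xi')$. Let $\mathbf{Mod}(\mathsf T,(\mathcal C,\Phi))$ be the category of models, $U$ its forgetful functor to $\mathcal C$, and $u$ the natural family of maps from $\mathbf{Mod}(\mathsf T,(\mathcal C,\Phi))((C,\xi),(C',\xi'))$ to $\Phi_T(C,C')$ given by $u(f)=\Phi_T(C,f)(\xi)$. **Double categories.** $\mathbb{PROF}^{\mathrm{op}}$ is the pseudo double category whose objects are the large categories and whose vertical morphisms are the functors. A horizontal morphism from $\mathcal A$ to $\mathcal B$ is a functor $H:\mathcal A^{\mathrm{op}}\times\mathcal B\to\mathbf{SET}$; a square from $H$ (top) to $H'$ (bottom) with left side $F$ and right side $G$ is a natural family of maps $H(A,B)\to H'(FA,GB)$; horizontal units are hom-functors, and the composite of $H$ followed by $K$ is $(A,C)\mapsto\int^{B}H(A,B)\times K(B,C)$. For a monoidal category $\mathcal N$, $\mathbb H\Sigma(\mathcal N)$ is the pseudo double category with one object, no vertical morphism other than the identity, the objects of $\mathcal N$ as horizontal morphisms (the composite of $X$ followed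 by $Y$ being $Y\otimes X$) and the morphisms of $\mathcal N$ as squares. A metamodel $\Phi$ is regarded as a lax double functor $\mathbb H\Sigma(\mathcal M^{\mathrm{op}})\to\mathbb{PROF}^{\mathrm{op}}$ that sends the object to $\mathcal C$ and $X$ to $\Phi_X$, with comparison squares given by the families $\phi_C$ and $\phi_{X,Y}$. **The diagram.** Let $\Delta_a$ be the category of finite ordinals $\mathbf n=\{0<\dots<n-1\}$, $n\ge 0$, and monotone maps, with ordinal sum as its monoidal structure; $\mathbf 1$ is a monoid object in it in a unique way. A strong monoidal functor $F:\Delta_a\to\mathcal M$ together with an isomorphism of monoids $\epsilon:F(\mathbf 1)\cong\mathsf T$ is said to correspond to $\mathsf T$. For such an $F$, let $\Phi(\mathsf T):\mathbb H\Sigma(\Delta_a^{\mathrm{op}})\to\mathbb{PROF}^{\mathrm{op}}$ be the composite of $\mathbb H\Sigma(F^{\mathrm{op}}):\mathbb H\Sigma(\Delta_a^{\mathrm{op}})\to\mathbb H\Sigma(\mathcal M^{\mathrm{op}})$ with the lax double functor $\Phi$. **Double limits.** A *vertical double cone* with vertex $A$ over a lax double functor $\Psi:\mathbb I\to\mathbb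 D$ is a vertical transformation to $\Psi$ from the double functor constant at $A$: vertical morphisms $x_i:A\to\Psi i$ and squares $x_X$ from the horizontal unit of $A$ to $\Psi X$ with sides $x_i,x_j$ (for each horizontal $X:i\to j$), compatible with vertical morphisms, squares, horizontal units and horizontal composition. Given cones $x,y$ with vertices $A,B$ and a horizontal morphism $H:A\to B$, a *modification* is a family of squares $\theta_i$ from $H$ to the horizontal unit of $\Psi i$, with sides $x_i,y_i$, compatible with vertical morphisms, and such that for each $X:i\to j$ the horizontal composite of $x_X$ and $\theta_j$ equals that of $\theta_i$ and $y_X$ (up to the unit isomorphisms). A vertical double cone $l$ with vertex $L$ is a *double limit* of $\Psi$, with apex $L$, if (1) each vertical double cone $x$, with vertex $A$, equals the composite of $l$ with a unique vertical morphism $A\to L$; and (2) for each modification $\theta$ as above, with $c:A\to L$ and $d:B\to L$ the factorizations of $x$ and $y$, there is a unique square $\sigma$ from $H$ to the horizontal unit of $L$, with sides $c,d$, such that for each $i$ the vertical composite of $\sigma$ with the unit square on $l_i$ is $\theta_i$. **Statement.** There is a strong monoidal functor $F:\Delta_a\to\mathcal M$ that corresponds to $\mathsf T$. For every strong monoidal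 functor $F$ corresponding to $\mathsf T$ via $\epsilon:F(\mathbf 1)\cong\mathsf T$, the category $\mathbf{Mod}(\mathsf T,(\mathcal C,\Phi))$ is the apex of the double limit of the lax double functor $\Phi(\mathsf T):\mathbb H\Sigma(\Delta_a^{\mathrm{op}})\to\mathbb{PROF}^{\mathrm{op}}$; more precisely, there is a vertical double cone over $\Phi(\mathsf T)$ with vertex $\mathbf{Mod}(\mathsf T,(\mathcal C,\Phi))$ that is a double limit, whose vertical component is the forgetful functor $U$ and whose square at $\mathbf 1$ is $u$ followed by $\Phi_\epsilon:\Phi_T\to\Phi_{F(\mathbf 1)}$. -/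

import Mathlib

set_option linter.checkUnivs false

open CategoryTheory MonoidalCategory Opposite

universe u u₁ u₂ u₃ v₁ v₂ v₃ w₁ w₂ w₃ x₁ x₂ x₃

/-! ### Pseudo double categories

Horizontal composition is weak and is written in diagrammatic order: `hcomp X Y` is
the composite of `X` followed by `Y`. -/

/-- The data of a pseudo double category, apart from the coherence isomorphisms: a category of
objects and vertical morphisms, horizontal morphisms, squares, vertical composition of squares,
and horizontal units and composition for horizontal morphisms and for squares.
`Sq X Y f g` is the type of squares with top `X`, bottom `Y`, left side `f` and right side `g`. -/
structure DoubleStruct where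
  Obj : Type u₁
  [vert : Category.{v₁} Obj]
  Hor : Obj → Obj → Type w₁
  Sq : ∀ {A B A' B' : Obj}, Hor A B → Hor A' B' → (A ⟶ A') → (B ⟶ B') → Type x₁
  sqId : ∀ {A B : Obj} (X : Hor A B), Sq X X (𝟙 A) (𝟙 B)
  sqComp : ∀ {A B A' B' A'' B'' : Obj} {X : Hor A B} {Y : Hor A' B'} {Z : Hor A'' B''}
    {f : A ⟶ A'} {g : B ⟶ B'} {f' : A' ⟶ A''} {g' : B' ⟶ B''},
    Sq X Y f g → Sq Y Z f' g' → Sq X Z (f ≫ f') (g ≫ g')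
  hid : ∀ A : Obj, Hor A A
  hidSq : ∀ {A A' : Obj} (f : A ⟶ A'), Sq (hid A) (hid A') f f
  hcomp : ∀ {A B C : Obj}, Hor A B → Hor B C → Hor A C
  hcompSq : ∀ {A B C A' B' C' : Obj} {X : Hor A B} {Y : Hor B C} {X' : Hor A' B'}
    {Y' : Hor B' C'} {f : A ⟶ A'} {g : B ⟶ B'} {h : C ⟶ C'},
    Sq X X' f g → Sq Y Y' g h → Sq (hcomp X Y) (hcomp X' Y') f h

attribute [instance] DoubleStruct.vert

/-- Equality of two squares with the same top and bottom, and whose vertical sides are equal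
(but possibly only provably so, as in `𝟙 A ≫ f = f`). -/
inductive DoubleStruct.SqEq (D : DoubleStruct.{u₁, v₁, w₁, x₁}) {A B A' B' : D.Obj}
    {X : D.Hor A B} {Y : D.Hor A' B'} :
    ∀ {f f' : A ⟶ A'} {g g' : B ⟶ B'}, D.Sq X Y f g → D.Sq X Y f' g' → Prop
  | refl {f : A ⟶ A'} {g : B ⟶ B'} (α : D.Sq X Y f g) : SqEq D α α

namespace DoubleStruct.SqEq

variable {D : DoubleStruct.{u₁, v₁, w₁, x₁}} {A B A' B' : D.Obj}
    {X : D.Hor A B} {Y : D.Hor A' B'} {f f' f'' : A ⟶ A'} {g g' g'' : B ⟶ B'}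

theorem of_eq {α β : D.Sq X Y f g} (h : α = β) : D.SqEq α β := h ▸ .refl α

theorem eq {α β : D.Sq X Y f g} (h : D.SqEq α β) : α = β := by
  cases h; rfl

theorem symm {α : D.Sq X Y f g} {β : D.Sq X Y f' g'} (h : D.SqEq α β) : D.SqEq β α := by
  cases h; exact .refl _

theorem trans {α : D.Sq X Y f g} {β : D.Sq X Y f' g'} {γ : D.Sq X Y f'' g''}
    (h : D.SqEq α β) (h' : D.SqEq β γ) : D.SqEq α γ := by
  cases h; exact h'

theorem comp {A'' B'' : D.Obj} {Z : D.Hor A'' B''} {k k' : A' ⟶ A''} {l l' : B' ⟶ B''}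
    {α : D.Sq X Y f g} {α' : D.Sq X Y f' g'} {β : D.Sq Y Z k l} {β' : D.Sq Y Z k' l'}
    (h : D.SqEq α α') (h' : D.SqEq β β') : D.SqEq (D.sqComp α β) (D.sqComp α' β') := by
  cases h; cases h'; exact .refl _

theorem hcomp {C C' : D.Obj} {Z : D.Hor B C} {Z' : D.Hor B' C'} {k k' : C ⟶ C'}
    {α : D.Sq X Y f g} {α' : D.Sq X Y f' g'} {β : D.Sq Z Z' g k} {β' : D.Sq Z Z' g' k'}
    (h : D.SqEq α α') (h' : D.SqEq β β') : D.SqEq (D.hcompSq α β) (D.hcompSq α' β') := by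
  cases h; cases h'; exact .refl _

end DoubleStruct.SqEq

/-- A pseudo double category. -/
structure PseudoDoubleCategory extends DoubleStruct.{u₁, v₁, w₁, x₁} where
  /- squares form a category, over the category of objects via both sides -/
  id_sqComp : ∀ {A B A' B' : Obj} {X : Hor A B} {Y : Hor A' B'} {f : A ⟶ A'} {g : B ⟶ B'}
    (α : Sq X Y f g), toDoubleStruct.SqEq (sqComp (sqId X) α) α
  sqComp_id : ∀ {A B A' B' : Obj} {X : Hor A B} {Y : Hor A' B'} {f : A ⟶ A'} {g : B ⟶ B'}
    (α : Sq X Y f g), toDoubleStruct.SqEq (sqComp α (sqId Y)) α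
  sqComp_assoc : ∀ {A₁ B₁ A₂ B₂ A₃ B₃ A₄ B₄ : Obj} {X₁ : Hor A₁ B₁} {X₂ : Hor A₂ B₂}
    {X₃ : Hor A₃ B₃} {X₄ : Hor A₄ B₄} {f₁ : A₁ ⟶ A₂} {g₁ : B₁ ⟶ B₂} {f₂ : A₂ ⟶ A₃}
    {g₂ : B₂ ⟶ B₃} {f₃ : A₃ ⟶ A₄} {g₃ : B₃ ⟶ B₄} (α : Sq X₁ X₂ f₁ g₁) (β : Sq X₂ X₃ f₂ g₂)
    (γ : Sq X₃ X₄ f₃ g₃),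
    toDoubleStruct.SqEq (sqComp (sqComp α β) γ) (sqComp α (sqComp β γ))
  /- horizontal units are functorial -/
  hidSq_id : ∀ A : Obj, hidSq (𝟙 A) = sqId (hid A)
  hidSq_comp : ∀ {A B C : Obj} (f : A ⟶ B) (g : B ⟶ C),
    hidSq (f ≫ g) = sqComp (hidSq f) (hidSq g)
  /- horizontal composition is functorial -/
  hcompSq_id : ∀ {A B C : Obj} (X : Hor A B) (Y : Hor B C),
    hcompSq (sqId X) (sqId Y) = sqId (hcomp X Y)
  hcompSq_comp : ∀ {A B C A' B' C' A'' B'' C'' : Obj} {X : Hor A B} {Y : Hor B C}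
    {X' : Hor A' B'} {Y' : Hor B' C'} {X'' : Hor A'' B''} {Y'' : Hor B'' C''}
    {f : A ⟶ A'} {g : B ⟶ B'} {h : C ⟶ C'} {f' : A' ⟶ A''} {g' : B' ⟶ B''} {h' : C' ⟶ C''}
    (α : Sq X X' f g) (β : Sq Y Y' g h) (α' : Sq X' X'' f' g') (β' : Sq Y' Y'' g' h'),
    hcompSq (sqComp α α') (sqComp β β') = sqComp (hcompSq α β) (hcompSq α' β')
  /- the associativity isomorphism -/
  assoc : ∀ {A B C E : Obj} (X : Hor A B) (Y : Hor B C) (Z : Hor C E),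
    Sq (hcomp (hcomp X Y) Z) (hcomp X (hcomp Y Z)) (𝟙 A) (𝟙 E)
  assocInv : ∀ {A B C E : Obj} (X : Hor A B) (Y : Hor B C) (Z : Hor C E),
    Sq (hcomp X (hcomp Y Z)) (hcomp (hcomp X Y) Z) (𝟙 A) (𝟙 E)
  assoc_assocInv : ∀ {A B C E : Obj} (X : Hor A B) (Y : Hor B C) (Z : Hor C E),
    toDoubleStruct.SqEq (sqComp (assoc X Y Z) (assocInv X Y Z)) (sqId _)
  assocInv_assoc : ∀ {A B C E : Obj} (X : Hor A B) (Y : Hor B C) (Z : Hor C E),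
    toDoubleStruct.SqEq (sqComp (assocInv X Y Z) (assoc X Y Z)) (sqId _)
  assoc_naturality : ∀ {A B C E A' B' C' E' : Obj} {X : Hor A B} {Y : Hor B C} {Z : Hor C E}
    {X' : Hor A' B'} {Y' : Hor B' C'} {Z' : Hor C' E'}
    {f : A ⟶ A'} {g : B ⟶ B'} {h : C ⟶ C'} {k : E ⟶ E'}
    (α : Sq X X' f g) (β : Sq Y Y' g h) (γ : Sq Z Z' h k),
    toDoubleStruct.SqEq (sqComp (hcompSq (hcompSq α β) γ) (assoc X' Y' Z'))
      (sqComp (assoc X Y Z) (hcompSq α (hcompSq β γ)))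
  /- the left unit isomorphism (unit first) -/
  lunit : ∀ {A B : Obj} (X : Hor A B), Sq (hcomp (hid A) X) X (𝟙 A) (𝟙 B)
  lunitInv : ∀ {A B : Obj} (X : Hor A B), Sq X (hcomp (hid A) X) (𝟙 A) (𝟙 B)
  lunit_lunitInv : ∀ {A B : Obj} (X : Hor A B),
    toDoubleStruct.SqEq (sqComp (lunit X) (lunitInv X)) (sqId _)
  lunitInv_lunit : ∀ {A B : Obj} (X : Hor A B),
    toDoubleStruct.SqEq (sqComp (lunitInv X) (lunit X)) (sqId _)
  lunit_naturality : ∀ {A B A' B' : Obj} {X : Hor A B} {X' : Hor A' B'} {f : A ⟶ A'}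
    {g : B ⟶ B'} (α : Sq X X' f g),
    toDoubleStruct.SqEq (sqComp (hcompSq (hidSq f) α) (lunit X')) (sqComp (lunit X) α)
  /- the right unit isomorphism (unit last) -/
  runit : ∀ {A B : Obj} (X : Hor A B), Sq (hcomp X (hid B)) X (𝟙 A) (𝟙 B)
  runitInv : ∀ {A B : Obj} (X : Hor A B), Sq X (hcomp X (hid B)) (𝟙 A) (𝟙 B)
  runit_runitInv : ∀ {A B : Obj} (X : Hor A B),
    toDoubleStruct.SqEq (sqComp (runit X) (runitInv X)) (sqId _)
  runitInv_runit : ∀ {A B : Obj} (X : Hor A B),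
    toDoubleStruct.SqEq (sqComp (runitInv X) (runit X)) (sqId _)
  runit_naturality : ∀ {A B A' B' : Obj} {X : Hor A B} {X' : Hor A' B'} {f : A ⟶ A'}
    {g : B ⟶ B'} (α : Sq X X' f g),
    toDoubleStruct.SqEq (sqComp (hcompSq α (hidSq g)) (runit X')) (sqComp (runit X) α)
  /- coherence -/
  pentagon : ∀ {A B C E F : Obj} (W : Hor A B) (X : Hor B C) (Y : Hor C E) (Z : Hor E F),
    toDoubleStruct.SqEq
      (sqComp (sqComp (hcompSq (assoc W X Y) (sqId Z)) (assoc W (hcomp X Y) Z))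
        (hcompSq (sqId W) (assoc X Y Z)))
      (sqComp (assoc (hcomp W X) Y Z) (assoc W X (hcomp Y Z)))
  triangle : ∀ {A B C : Obj} (X : Hor A B) (Y : Hor B C),
    toDoubleStruct.SqEq (sqComp (assoc X (hid B) Y) (hcompSq (sqId X) (lunit Y)))
      (hcompSq (runit X) (sqId Y))

/-! ### Lax double functors -/

/-- A lax double functor between pseudo double categories: strictly functorial in the vertical
direction, with comparison squares `unit` and `mul` for horizontal units and composites. -/
structure LaxDoubleFunctor (I : PseudoDoubleCategory.{u₁, v₁, w₁, x₁})
    (D : PseudoDoubleCategory.{u₂, v₂, w₂, x₂}) where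
  vert : I.Obj ⥤ D.Obj
  hor : ∀ {i j : I.Obj}, I.Hor i j → D.Hor (vert.obj i) (vert.obj j)
  sq : ∀ {i j i' j' : I.Obj} {X : I.Hor i j} {Y : I.Hor i' j'} {f : i ⟶ i'} {g : j ⟶ j'},
    I.Sq X Y f g → D.Sq (hor X) (hor Y) (vert.map f) (vert.map g)
  sq_id : ∀ {i j : I.Obj} (X : I.Hor i j), D.SqEq (sq (I.sqId X)) (D.sqId (hor X))
  sq_comp : ∀ {i j i' j' i'' j'' : I.Obj} {X : I.Hor i j} {Y : I.Hor i' j'} {Z : I.Hor i'' j''}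
    {f : i ⟶ i'} {g : j ⟶ j'} {f' : i' ⟶ i''} {g' : j' ⟶ j''}
    (α : I.Sq X Y f g) (β : I.Sq Y Z f' g'),
    D.SqEq (sq (I.sqComp α β)) (D.sqComp (sq α) (sq β))
  unit : ∀ i : I.Obj, D.Sq (D.hid (vert.obj i)) (hor (I.hid i)) (𝟙 _) (𝟙 _)
  unit_naturality : ∀ {i j : I.Obj} (f : i ⟶ j),
    D.SqEq (D.sqComp (D.hidSq (vert.map f)) (unit j)) (D.sqComp (unit i) (sq (I.hidSq f)))
  mul : ∀ {i j k : I.Obj} (X : I.Hor i j) (Y : I.Hor j k),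
    D.Sq (D.hcomp (hor X) (hor Y)) (hor (I.hcomp X Y)) (𝟙 _) (𝟙 _)
  mul_naturality : ∀ {i j k i' j' k' : I.Obj} {X : I.Hor i j} {Y : I.Hor j k}
    {X' : I.Hor i' j'} {Y' : I.Hor j' k'} {f : i ⟶ i'} {g : j ⟶ j'} {h : k ⟶ k'}
    (α : I.Sq X X' f g) (β : I.Sq Y Y' g h),
    D.SqEq (D.sqComp (D.hcompSq (sq α) (sq β)) (mul X' Y'))
      (D.sqComp (mul X Y) (sq (I.hcompSq α β)))
  mul_assoc : ∀ {i j k l : I.Obj} (X : I.Hor i j) (Y : I.Hor j k) (Z : I.Hor k l),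
    D.SqEq
      (D.sqComp (D.sqComp (D.hcompSq (mul X Y) (D.sqId (hor Z))) (mul (I.hcomp X Y) Z))
        (sq (I.assoc X Y Z)))
      (D.sqComp (D.sqComp (D.assoc (hor X) (hor Y) (hor Z))
        (D.hcompSq (D.sqId (hor X)) (mul Y Z))) (mul X (I.hcomp Y Z)))
  unit_mul : ∀ {i j : I.Obj} (X : I.Hor i j),
    D.SqEq (D.sqComp (D.sqComp (D.hcompSq (unit i) (D.sqId (hor X))) (mul (I.hid i) X))
      (sq (I.lunit X))) (D.lunit (hor X))
  mul_unit : ∀ {i j : I.Obj} (X : I.Hor i j),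
    D.SqEq (D.sqComp (D.sqComp (D.hcompSq (D.sqId (hor X)) (unit j)) (mul X (I.hid j)))
      (sq (I.runit X))) (D.runit (hor X))

theorem LaxDoubleFunctor.sq_congr {I : PseudoDoubleCategory.{u₁, v₁, w₁, x₁}}
    {D : PseudoDoubleCategory.{u₂, v₂, w₂, x₂}} (F : LaxDoubleFunctor I D) {i j i' j' : I.Obj}
    {X : I.Hor i j} {Y : I.Hor i' j'} {f f' : i ⟶ i'} {g g' : j ⟶ j'}
    {α : I.Sq X Y f g} {β : I.Sq X Y f' g'} (h : I.SqEq α β) : D.SqEq (F.sq α) (F.sq β) := by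
  cases h; exact .refl _

/-- Transport of a square along equalities of its vertical sides. -/
def DoubleStruct.castSq (D : DoubleStruct.{u₁, v₁, w₁, x₁}) {A B A' B' : D.Obj}
    {X : D.Hor A B} {Y : D.Hor A' B'} {f f' : A ⟶ A'} {g g' : B ⟶ B'} (hf : f = f') (hg : g = g')
    (α : D.Sq X Y f g) : D.Sq X Y f' g' :=
  hf ▸ hg ▸ α

theorem DoubleStruct.castSq_sqEq (D : DoubleStruct.{u₁, v₁, w₁, x₁}) {A B A' B' : D.Obj}
    {X : D.Hor A B} {Y : D.Hor A' B'} {f f' : A ⟶ A'} {g g' : B ⟶ B'} (hf : f = f') (hg : g = g')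
    (α : D.Sq X Y f g) : D.SqEq (D.castSq hf hg α) α := by
  subst hf hg; exact .refl _

/-- The objects of the category whose morphisms are the squares of `D`. -/
structure PseudoDoubleCategory.HorObj (D : PseudoDoubleCategory.{u₁, v₁, w₁, x₁}) where
  {src tgt : D.Obj}
  hor : D.Hor src tgt

/-- The morphisms of the category of horizontal morphisms and squares of `D`. -/
structure PseudoDoubleCategory.SqHom (D : PseudoDoubleCategory.{u₁, v₁, w₁, x₁})
    (X Y : D.HorObj) where
  {left : X.src ⟶ Y.src}
  {right : X.tgt ⟶ Y.tgt}
  sq : D.Sq X.hor Y.hor left right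

theorem PseudoDoubleCategory.SqHom.mk_eq {D : PseudoDoubleCategory.{u₁, v₁, w₁, x₁}}
    {A B A' B' : D.Obj} {X : D.Hor A B} {Y : D.Hor A' B'} {f f' : A ⟶ A'} {g g' : B ⟶ B'}
    {α : D.Sq X Y f g} {β : D.Sq X Y f' g'} (h : D.SqEq α β) :
    (SqHom.mk α : D.SqHom ⟨X⟩ ⟨Y⟩) = SqHom.mk β := by
  cases h; rfl

theorem PseudoDoubleCategory.SqHom.sqEq {D : PseudoDoubleCategory.{u₁, v₁, w₁, x₁}}
    {A B A' B' : D.Obj} {X : D.Hor A B} {Y : D.Hor A' B'} {f f' : A ⟶ A'} {g g' : B ⟶ B'}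
    {α : D.Sq X Y f g} {β : D.Sq X Y f' g'}
    (h : (SqHom.mk α : D.SqHom ⟨X⟩ ⟨Y⟩) = SqHom.mk β) : D.SqEq α β := by
  injection h with h₁ h₂ h₃
  subst h₁ h₂
  exact .of_eq (eq_of_heq h₃)

instance (D : PseudoDoubleCategory.{u₁, v₁, w₁, x₁}) : Category D.HorObj where
  Hom X Y := D.SqHom X Y
  id X := ⟨D.sqId X.hor⟩
  comp α β := ⟨D.sqComp α.sq β.sq⟩
  id_comp α := PseudoDoubleCategory.SqHom.mk_eq (D.id_sqComp α.sq)
  comp_id α := PseudoDoubleCategory.SqHom.mk_eq (D.sqComp_id α.sq)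
  assoc α β γ := PseudoDoubleCategory.SqHom.mk_eq (D.sqComp_assoc α.sq β.sq γ.sq)

/-- A square of `D`, as a morphism between horizontal morphisms. -/
def PseudoDoubleCategory.hom (D : PseudoDoubleCategory.{u₁, v₁, w₁, x₁})
    {A B A' B' : D.Obj} {X : D.Hor A B} {Y : D.Hor A' B'} {f : A ⟶ A'} {g : B ⟶ B'}
    (α : D.Sq X Y f g) : (⟨X⟩ : D.HorObj) ⟶ ⟨Y⟩ :=
  PseudoDoubleCategory.SqHom.mk α

section

variable {D : PseudoDoubleCategory.{u₁, v₁, w₁, x₁}} {A B A' B' A'' B'' : D.Obj}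
    {X : D.Hor A B} {Y : D.Hor A' B'} {Z : D.Hor A'' B''} {f f' : A ⟶ A'} {g g' : B ⟶ B'}
    {k : A' ⟶ A''} {l : B' ⟶ B''}

theorem PseudoDoubleCategory.sqEq_iff {α : D.Sq X Y f g} {β : D.Sq X Y f' g'} :
    D.SqEq α β ↔ D.hom α = D.hom β :=
  ⟨PseudoDoubleCategory.SqHom.mk_eq, PseudoDoubleCategory.SqHom.sqEq⟩

theorem PseudoDoubleCategory.hom_comp (α : D.Sq X Y f g) (β : D.Sq Y Z k l) :
    D.hom (D.sqComp α β) = D.hom α ≫ D.hom β := rfl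

theorem PseudoDoubleCategory.hom_cast (hf : f = f') (hg : g = g') (α : D.Sq X Y f g) :
    D.hom (D.castSq hf hg α) = D.hom α :=
  PseudoDoubleCategory.sqEq_iff.1 (D.castSq_sqEq hf hg α)

end

section

variable {D : PseudoDoubleCategory.{u₂, v₂, w₂, x₂}} {E : PseudoDoubleCategory.{u₃, v₃, w₃, x₃}}
    (G : LaxDoubleFunctor D E) {P Q R : D.Obj}

theorem LaxDoubleFunctor.hom_whiskerRight {X : E.Hor (G.vert.obj P) (G.vert.obj Q)}
    {Y Y' : D.Hor P Q} (a : E.Sq X (G.hor Y) (𝟙 _) (𝟙 _)) (b : D.Sq Y Y' (𝟙 P) (𝟙 Q))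
    (Z : D.Hor Q R) (h₁ : 𝟙 _ ≫ G.vert.map (𝟙 P) = 𝟙 _) (h₂ : 𝟙 _ ≫ G.vert.map (𝟙 Q) = 𝟙 _) :
    E.hom (E.hcompSq (E.castSq h₁ h₂ (E.sqComp a (G.sq b))) (E.sqId (G.hor Z))) =
      E.hom (E.hcompSq a (E.sqId (G.hor Z))) ≫
        E.hom (E.hcompSq (G.sq b) (G.sq (D.sqId Z))) := by
  rw [← PseudoDoubleCategory.hom_comp, ← E.hcompSq_comp, ← PseudoDoubleCategory.sqEq_iff]
  exact (E.castSq_sqEq h₁ h₂ _).hcomp ((E.id_sqComp _).symm.trans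
    ((DoubleStruct.SqEq.refl _).comp (G.sq_id Z).symm))

theorem LaxDoubleFunctor.hom_whiskerLeft {X : E.Hor (G.vert.obj Q) (G.vert.obj R)}
    {Y Y' : D.Hor Q R} (a : E.Sq X (G.hor Y) (𝟙 _) (𝟙 _)) (b : D.Sq Y Y' (𝟙 Q) (𝟙 R))
    (Z : D.Hor P Q) (h₁ : 𝟙 _ ≫ G.vert.map (𝟙 Q) = 𝟙 _) (h₂ : 𝟙 _ ≫ G.vert.map (𝟙 R) = 𝟙 _) :
    E.hom (E.hcompSq (E.sqId (G.hor Z)) (E.castSq h₁ h₂ (E.sqComp a (G.sq b)))) =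
      E.hom (E.hcompSq (E.sqId (G.hor Z)) a) ≫
        E.hom (E.hcompSq (G.sq (D.sqId Z)) (G.sq b)) := by
  rw [← PseudoDoubleCategory.hom_comp, ← E.hcompSq_comp, ← PseudoDoubleCategory.sqEq_iff]
  exact ((E.id_sqComp _).symm.trans
    ((DoubleStruct.SqEq.refl _).comp (G.sq_id Z).symm)).hcomp (E.castSq_sqEq h₁ h₂ _)

theorem LaxDoubleFunctor.hom_sq_comp {A B A' B' A'' B'' : D.Obj}
    {X : D.Hor A B} {Y : D.Hor A' B'} {Z : D.Hor A'' B''} {f : A ⟶ A'} {g : B ⟶ B'}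
    {k : A' ⟶ A''} {l : B' ⟶ B''} (α : D.Sq X Y f g) (β : D.Sq Y Z k l) :
    E.hom (G.sq (D.sqComp α β)) = E.hom (G.sq α) ≫ E.hom (G.sq β) :=
  PseudoDoubleCategory.sqEq_iff.1 (G.sq_comp α β)

end

/-- Composition of lax double functors. -/
def LaxDoubleFunctor.comp {I : PseudoDoubleCategory.{u₁, v₁, w₁, x₁}}
    {D : PseudoDoubleCategory.{u₂, v₂, w₂, x₂}} {E : PseudoDoubleCategory.{u₃, v₃, w₃, x₃}}
    (F : LaxDoubleFunctor I D) (G : LaxDoubleFunctor D E) : LaxDoubleFunctor I E where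
  vert := F.vert ⋙ G.vert
  hor X := G.hor (F.hor X)
  sq α := G.sq (F.sq α)
  sq_id X := (G.sq_congr (F.sq_id X)).trans (G.sq_id _)
  sq_comp α β := (G.sq_congr (F.sq_comp α β)).trans (G.sq_comp _ _)
  unit i := E.castSq (by simp) (by simp) (E.sqComp (G.unit (F.vert.obj i)) (G.sq (F.unit i)))
  unit_naturality {i j} f := by
    have h1 := PseudoDoubleCategory.sqEq_iff.1 (G.unit_naturality (F.vert.map f))
    have h2 := PseudoDoubleCategory.sqEq_iff.1 (G.sq_congr (F.unit_naturality f))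
    have h3 := PseudoDoubleCategory.sqEq_iff.1 (G.sq_comp (D.hidSq (F.vert.map f)) (F.unit j))
    have h4 := PseudoDoubleCategory.sqEq_iff.1 (G.sq_comp (F.unit i) (F.sq (I.hidSq f)))
    rw [PseudoDoubleCategory.sqEq_iff]
    simp only [PseudoDoubleCategory.hom_comp, PseudoDoubleCategory.hom_cast] at *
    erw [reassoc_of% h1, ← h3, h2, h4, Category.assoc]
  mul X Y := E.castSq (by simp) (by simp)
    (E.sqComp (G.mul (F.hor X) (F.hor Y)) (G.sq (F.mul X Y)))
  mul_naturality {i j k i' j' k' X Y X' Y' f g h} α β := by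
    have h1 := PseudoDoubleCategory.sqEq_iff.1 (G.mul_naturality (F.sq α) (F.sq β))
    have h2 := PseudoDoubleCategory.sqEq_iff.1 (G.sq_congr (F.mul_naturality α β))
    have h3 := PseudoDoubleCategory.sqEq_iff.1
      (G.sq_comp (D.hcompSq (F.sq α) (F.sq β)) (F.mul X' Y'))
    have h4 := PseudoDoubleCategory.sqEq_iff.1
      (G.sq_comp (F.mul X Y) (F.sq (I.hcompSq α β)))
    rw [PseudoDoubleCategory.sqEq_iff]
    simp only [PseudoDoubleCategory.hom_comp, PseudoDoubleCategory.hom_cast] at *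
    rw [reassoc_of% h1, ← h3, h2, h4, Category.assoc]
  mul_assoc X Y Z := by
    have h1 := PseudoDoubleCategory.sqEq_iff.1 (G.mul_assoc (F.hor X) (F.hor Y) (F.hor Z))
    have h2 := PseudoDoubleCategory.sqEq_iff.1 (G.sq_congr (F.mul_assoc X Y Z))
    have h3 := PseudoDoubleCategory.sqEq_iff.1
      (G.mul_naturality (F.mul X Y) (D.sqId (F.hor Z)))
    have h4 := PseudoDoubleCategory.sqEq_iff.1
      (G.mul_naturality (D.sqId (F.hor X)) (F.mul Y Z))
    rw [PseudoDoubleCategory.sqEq_iff]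
    simp only [PseudoDoubleCategory.hom_comp, PseudoDoubleCategory.hom_cast,
      LaxDoubleFunctor.hom_sq_comp, Category.assoc] at h1 h2 h3 h4 ⊢
    erw [LaxDoubleFunctor.hom_whiskerRight, LaxDoubleFunctor.hom_whiskerLeft]
    simp only [Category.assoc]
    erw [reassoc_of% h3, h2, reassoc_of% h1, reassoc_of% h4]
  unit_mul {i j} X := by
    have h1 := PseudoDoubleCategory.sqEq_iff.1 (G.unit_mul (F.hor X))
    have h2 := PseudoDoubleCategory.sqEq_iff.1 (G.sq_congr (F.unit_mul X))
    have h3 := PseudoDoubleCategory.sqEq_iff.1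
      (G.mul_naturality (F.unit i) (D.sqId (F.hor X)))
    rw [PseudoDoubleCategory.sqEq_iff]
    simp only [PseudoDoubleCategory.hom_comp, PseudoDoubleCategory.hom_cast,
      LaxDoubleFunctor.hom_sq_comp, Category.assoc] at h1 h2 h3 ⊢
    erw [LaxDoubleFunctor.hom_whiskerRight]
    simp only [Category.assoc]
    erw [reassoc_of% h3, h2, h1]
  mul_unit {i j} X := by
    have h1 := PseudoDoubleCategory.sqEq_iff.1 (G.mul_unit (F.hor X))
    have h2 := PseudoDoubleCategory.sqEq_iff.1 (G.sq_congr (F.mul_unit X))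
    have h3 := PseudoDoubleCategory.sqEq_iff.1
      (G.mul_naturality (D.sqId (F.hor X)) (F.unit j))
    rw [PseudoDoubleCategory.sqEq_iff]
    simp only [PseudoDoubleCategory.hom_comp, PseudoDoubleCategory.hom_cast,
      LaxDoubleFunctor.hom_sq_comp, Category.assoc] at h1 h2 h3 ⊢
    erw [LaxDoubleFunctor.hom_whiskerLeft]
    simp only [Category.assoc]
    erw [reassoc_of% h3, h2, h1]

/-! ### Vertical double cones and double limits -/

/-- A vertical double cone with vertex `A` over a lax double functor `F`, i.e. a vertical
transformation from the double functor constant at `A` to `F`. -/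
structure VerticalDoubleCone {I : PseudoDoubleCategory.{u₁, v₁, w₁, x₁}}
    {D : PseudoDoubleCategory.{u₂, v₂, w₂, x₂}} (F : LaxDoubleFunctor I D) (A : D.Obj) where
  leg : ∀ i : I.Obj, A ⟶ F.vert.obj i
  leg_naturality : ∀ {i j : I.Obj} (f : i ⟶ j), leg i ≫ F.vert.map f = leg j
  cell : ∀ {i j : I.Obj} (X : I.Hor i j), D.Sq (D.hid A) (F.hor X) (leg i) (leg j)
  cell_naturality : ∀ {i j i' j' : I.Obj} {X : I.Hor i j} {Y : I.Hor i' j'} {f : i ⟶ i'}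
    {g : j ⟶ j'} (α : I.Sq X Y f g), D.SqEq (D.sqComp (cell X) (F.sq α)) (cell Y)
  cell_hid : ∀ i : I.Obj, D.SqEq (cell (I.hid i)) (D.sqComp (D.hidSq (leg i)) (F.unit i))
  cell_hcomp : ∀ {i j k : I.Obj} (X : I.Hor i j) (Y : I.Hor j k),
    D.SqEq (cell (I.hcomp X Y))
      (D.sqComp (D.sqComp (D.lunitInv (D.hid A)) (D.hcompSq (cell X) (cell Y))) (F.mul X Y))

/-- The vertical morphism `c` is a morphism of vertical double cones from `x` to `y`: composing
`y` with `c` gives `x`. -/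
structure VerticalDoubleCone.IsFactorization {I : PseudoDoubleCategory.{u₁, v₁, w₁, x₁}}
    {D : PseudoDoubleCategory.{u₂, v₂, w₂, x₂}} {F : LaxDoubleFunctor I D} {A B : D.Obj}
    (x : VerticalDoubleCone F A) (y : VerticalDoubleCone F B) (c : A ⟶ B) : Prop where
  leg : ∀ i : I.Obj, c ≫ y.leg i = x.leg i
  cell : ∀ {i j : I.Obj} (X : I.Hor i j),
    D.SqEq (D.sqComp (D.hidSq c) (y.cell X)) (x.cell X)

/-- A modification from a horizontal morphism `H` to `F`, whose vertical boundary consists of two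
vertical double cones `x` and `y` over `F`: a family of squares from `H` to the horizontal
units of the `F i`, compatible with the vertical morphisms and the horizontal morphisms of the
indexing double category. -/
structure ConeModification {I : PseudoDoubleCategory.{u₁, v₁, w₁, x₁}}
    {D : PseudoDoubleCategory.{u₂, v₂, w₂, x₂}} {F : LaxDoubleFunctor I D} {A B : D.Obj}
    (x : VerticalDoubleCone F A) (y : VerticalDoubleCone F B) (H : D.Hor A B) where
  app : ∀ i : I.Obj, D.Sq H (D.hid (F.vert.obj i)) (x.leg i) (y.leg i)
  naturality_vert : ∀ {i j : I.Obj} (f : i ⟶ j),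
    D.SqEq (D.sqComp (app i) (D.hidSq (F.vert.map f))) (app j)
  naturality_hor : ∀ {i j : I.Obj} (X : I.Hor i j),
    D.SqEq
      (D.sqComp (D.sqComp (D.lunitInv H) (D.hcompSq (x.cell X) (app j))) (D.runit (F.hor X)))
      (D.sqComp (D.sqComp (D.runitInv H) (D.hcompSq (app i) (y.cell X))) (D.lunit (F.hor X)))

/-- The vertical double cone `l` over `F` is a double limit of `F`: every vertical double cone
over `F` factors uniquely through `l`, and so does every modification between such cones. -/
structure VerticalDoubleCone.IsDoubleLimit {I : PseudoDoubleCategory.{u₁, v₁, w₁, x₁}}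
    {D : PseudoDoubleCategory.{u₂, v₂, w₂, x₂}} {F : LaxDoubleFunctor I D} {L : D.Obj}
    (l : VerticalDoubleCone F L) : Prop where
  existsUnique_vert : ∀ {A : D.Obj} (x : VerticalDoubleCone F A),
    ∃! c : A ⟶ L, x.IsFactorization l c
  existsUnique_sq : ∀ {A B : D.Obj} (x : VerticalDoubleCone F A) (y : VerticalDoubleCone F B)
    (H : D.Hor A B) (ξ : ConeModification x y H) (c : A ⟶ L) (d : B ⟶ L),
    x.IsFactorization l c → y.IsFactorization l d →
    ∃! σ : D.Sq H (D.hid L) c d, ∀ i : I.Obj,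
      D.SqEq (D.sqComp σ (D.hidSq (l.leg i))) (ξ.app i)

/-! ### The pseudo double category of a monoidal category -/

/-- The vertically discrete pseudo double category `ℍΣN` of a monoidal category `N`, seen as a
bicategory with one object: there is one object and no vertical morphism but the identity,
the horizontal morphisms are the objects of `N`, and the squares are the morphisms of `N`.
The composite of `X` followed by `Y` is `Y ⊗ X`. -/
def HSigmaStruct (N : Type u₁) [Category.{v₁} N] [MonoidalCategory N] :
    DoubleStruct.{0, 0, u₁, v₁} where
  Obj := Discrete PUnit.{1}
  Hor _ _ := N
  Sq X Y _ _ := X ⟶ Y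
  sqId X := 𝟙 X
  sqComp α β := α ≫ β
  hid _ := 𝟙_ N
  hidSq _ := 𝟙 (𝟙_ N)
  hcomp X Y := Y ⊗ X
  hcompSq α β := β ⊗ₘ α

theorem HSigmaStruct.sqEq {N : Type u₁} [Category.{v₁} N] [MonoidalCategory N]
    {a b a' b' : Discrete PUnit.{1}} {X Y : N} {f f' : a ⟶ a'} {g g' : b ⟶ b'}
    {α β : X ⟶ Y} (h : α = β) :
    @DoubleStruct.SqEq (HSigmaStruct N) a b a' b' X Y f f' g g' α β := by
  obtain rfl : f = f' := Subsingleton.elim _ _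
  obtain rfl : g = g' := Subsingleton.elim _ _
  subst h
  exact .refl _

/-- The pseudo double category `ℍΣN` of a monoidal category `N`; its data are described at
`HSigmaStruct`. -/
def HSigma (N : Type u₁) [Category.{v₁} N] [MonoidalCategory N] :
    PseudoDoubleCategory.{0, 0, u₁, v₁} where
  toDoubleStruct := HSigmaStruct N
  id_sqComp α := HSigmaStruct.sqEq (Category.id_comp (obj := N) α)
  sqComp_id α := HSigmaStruct.sqEq (Category.comp_id (obj := N) α)
  sqComp_assoc α β γ := HSigmaStruct.sqEq (Category.assoc (obj := N) α β γ)
  hidSq_id _ := rfl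
  hidSq_comp _ _ := (Category.comp_id (𝟙 (𝟙_ N))).symm
  hcompSq_id X Y := id_tensorHom_id (C := N) Y X
  hcompSq_comp α β α' β' := (tensorHom_comp_tensorHom (C := N) β α β' α').symm
  assoc X Y Z := (MonoidalCategory.associator (C := N) Z Y X).inv
  assocInv X Y Z := (MonoidalCategory.associator (C := N) Z Y X).hom
  assoc_assocInv X Y Z := HSigmaStruct.sqEq (MonoidalCategory.associator (C := N) Z Y X).inv_hom_id
  assocInv_assoc X Y Z := HSigmaStruct.sqEq (MonoidalCategory.associator (C := N) Z Y X).hom_inv_id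
  assoc_naturality α β γ := HSigmaStruct.sqEq (associator_inv_naturality (C := N) γ β α)
  lunit X := (MonoidalCategory.rightUnitor (C := N) X).hom
  lunitInv X := (MonoidalCategory.rightUnitor (C := N) X).inv
  lunit_lunitInv X := HSigmaStruct.sqEq (MonoidalCategory.rightUnitor (C := N) X).hom_inv_id
  lunitInv_lunit X := HSigmaStruct.sqEq (MonoidalCategory.rightUnitor (C := N) X).inv_hom_id
  lunit_naturality α := HSigmaStruct.sqEq (by
    have key : ∀ {P Q : N} (a : P ⟶ Q),
        (a ⊗ₘ 𝟙 (𝟙_ N)) ≫ (ρ_ Q).hom = (ρ_ P).hom ≫ a := by intros; simp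
    exact key α)
  runit X := (MonoidalCategory.leftUnitor (C := N) X).hom
  runitInv X := (MonoidalCategory.leftUnitor (C := N) X).inv
  runit_runitInv X := HSigmaStruct.sqEq (MonoidalCategory.leftUnitor (C := N) X).hom_inv_id
  runitInv_runit X := HSigmaStruct.sqEq (MonoidalCategory.leftUnitor (C := N) X).inv_hom_id
  runit_naturality α := HSigmaStruct.sqEq (by
    have key : ∀ {P Q : N} (a : P ⟶ Q),
        (𝟙 (𝟙_ N) ⊗ₘ a) ≫ (λ_ Q).hom = (λ_ P).hom ≫ a := by intros; simp
    exact key α)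
  pentagon W X Y Z := HSigmaStruct.sqEq (by
    have key : ∀ W X Y Z : N, ((𝟙 Z ⊗ₘ (α_ Y X W).inv) ≫ (α_ Z (Y ⊗ X) W).inv) ≫
        ((α_ Z Y X).inv ⊗ₘ 𝟙 W) = (α_ Z Y (X ⊗ W)).inv ≫ (α_ (Z ⊗ Y) X W).inv := by
      intros; simp
    exact key W X Y Z)
  triangle X Y := HSigmaStruct.sqEq (by
    have key : ∀ X Y : N,
        (α_ Y (𝟙_ N) X).inv ≫ ((ρ_ Y).hom ⊗ₘ 𝟙 X) = (𝟙 Y ⊗ₘ (λ_ X).hom) := by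
      intros; simp
    exact key X Y)

/-- A lax monoidal functor induces a lax double functor. -/
def HSigma.map {N : Type u₁} [Category.{v₁} N] [MonoidalCategory N] {N' : Type u₂}
    [Category.{v₂} N'] [MonoidalCategory N'] (G : N ⥤ N') [G.LaxMonoidal] :
    LaxDoubleFunctor (HSigma N) (HSigma N') where
  vert := 𝟭 (Discrete PUnit.{1})
  hor X := G.obj X
  sq α := G.map α
  sq_id X := HSigmaStruct.sqEq (G.map_id X)
  sq_comp α β := HSigmaStruct.sqEq (G.map_comp α β)
  unit _ := Functor.LaxMonoidal.ε G
  unit_naturality _ := HSigmaStruct.sqEq (by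
    change 𝟙 (𝟙_ N') ≫ Functor.LaxMonoidal.ε G = Functor.LaxMonoidal.ε G ≫ G.map (𝟙 (𝟙_ N))
    simp)
  mul X Y := Functor.LaxMonoidal.μ G Y X
  mul_naturality α β := HSigmaStruct.sqEq (Functor.LaxMonoidal.μ_natural G β α)
  mul_assoc X Y Z := HSigmaStruct.sqEq (by
    have key : ∀ X Y Z : N, ((𝟙 (G.obj Z) ⊗ₘ Functor.LaxMonoidal.μ G Y X) ≫
          Functor.LaxMonoidal.μ G Z (Y ⊗ X)) ≫ G.map (α_ Z Y X).inv =
        ((α_ (G.obj Z) (G.obj Y) (G.obj X)).inv ≫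
          (Functor.LaxMonoidal.μ G Z Y ⊗ₘ 𝟙 (G.obj X))) ≫
          Functor.LaxMonoidal.μ G (Z ⊗ Y) X := by
      intros; simp
    exact key X Y Z)
  unit_mul X := HSigmaStruct.sqEq (by
    have key : ∀ X : N, ((𝟙 (G.obj X) ⊗ₘ Functor.LaxMonoidal.ε G) ≫
        Functor.LaxMonoidal.μ G X (𝟙_ N)) ≫ G.map (ρ_ X).hom = (ρ_ (G.obj X)).hom := by
      intros; simp
    exact key X)
  mul_unit X := HSigmaStruct.sqEq (by
    have key : ∀ X : N, ((Functor.LaxMonoidal.ε G ⊗ₘ 𝟙 (G.obj X)) ≫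
        Functor.LaxMonoidal.μ G (𝟙_ N) X) ≫ G.map (λ_ X).hom = (λ_ (G.obj X)).hom := by
      intros; simp
    exact key X)

/-- The opposite of an oplax monoidal functor is lax monoidal. -/
instance laxMonoidalOp {N : Type u₁} [Category.{v₁} N] [MonoidalCategory N] {N' : Type u₂}
    [Category.{v₂} N'] [MonoidalCategory N'] (F : N ⥤ N') [F.OplaxMonoidal] :
    F.op.LaxMonoidal where
  ε := (Functor.OplaxMonoidal.η F).op
  μ X Y := (Functor.OplaxMonoidal.δ F X.unop Y.unop).op
  μ_natural_left f X := Quiver.Hom.unop_inj (by simp)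
  μ_natural_right X f := Quiver.Hom.unop_inj (by simp)
  associativity X Y Z := Quiver.Hom.unop_inj (by simp)
  left_unitality X := Quiver.Hom.unop_inj (by simp)
  right_unitality X := Quiver.Hom.unop_inj (by simp)

/-! ### Profunctors

For `H : Profunctor B A`, that is `H : B ⥤ Aᵒᵖ ⥤ Type u`, we write `el H a b` for the set
`H(a, b)`, contravariant in `a` and covariant in `b`. -/

namespace ProfOp

section

variable {A B C E : Type u} [Category.{u} A] [Category.{u} B] [Category.{u} C] [Category.{u} E]

/-- The set `H(a, b)`. -/
def el (H : Profunctor.{u} B A) (a : A) (b : B) : Type u := (H.obj b).obj (op a)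

/-- The map `H(f, g) : H(a', b) → H(a, b')`. -/
def act (H : Profunctor.{u} B A) {a a' : A} {b b' : B} (f : a ⟶ a') (g : b ⟶ b')
    (x : el H a' b) : el H a b' :=
  (H.map g).app (op a) ((H.obj b).map f.op x)

@[simp]
theorem act_id (H : Profunctor.{u} B A) {a : A} {b : B} (x : el H a b) :
    act H (𝟙 a) (𝟙 b) x = x := by
  have key : ∀ x : (H.obj b).obj (op a),
      (H.map (𝟙 b)).app (op a) ((H.obj b).map (𝟙 a).op x) = x := by simp
  exact key x

@[simp]
theorem act_act (H : Profunctor.{u} B A) {a a' a'' : A} {b b' b'' : B} (f : a ⟶ a')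
    (f' : a' ⟶ a'') (g : b ⟶ b') (g' : b' ⟶ b'') (x : el H a'' b) :
    act H f g' (act H f' g x) = act H (f ≫ f') (g ≫ g') x := by
  have key : ∀ x : (H.obj b).obj (op a''),
      (H.map g').app (op a) ((H.obj b').map f.op
        ((H.map g).app (op a') ((H.obj b).map f'.op x))) =
      (H.map (g ≫ g')).app (op a) ((H.obj b).map (f ≫ f').op x) := fun x => by
    have h := congr_fun (congr_arg (fun k => (ConcreteCategory.hom k : _ → _))
      ((H.map g).naturality f.op)) ((H.obj b).map f'.op x)
    simp only [ConcreteCategory.comp_apply] at h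
    simp [h]
  exact key x

/-- A profunctor, from its sets `H(a, b)` and maps `H(f, g)`. -/
def ofAct (S : A → B → Type u)
    (s : ∀ {a a' : A} {b b' : B}, (a ⟶ a') → (b ⟶ b') → S a' b → S a b')
    (s_id : ∀ {a : A} {b : B} (x : S a b), s (𝟙 a) (𝟙 b) x = x)
    (s_comp : ∀ {a a' a'' : A} {b b' b'' : B} (f : a ⟶ a') (f' : a' ⟶ a'') (g : b ⟶ b')
      (g' : b' ⟶ b'') (x : S a'' b), s (f ≫ f') (g ≫ g') x = s f g' (s f' g x)) :
    Profunctor.{u} B A :=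
  .ofCore {
    obj := fun b a => S a b
    map := fun g f => TypeCat.ofHom (s f g)
    map_id := fun b a => by ext x; exact s_id x
    map_comp := fun g g' f f' => by ext x; exact s_comp f f' g g' x }

/-- The generating relation of the coend `∫^b H(a, b) × K(b, c)`. -/
inductive CoendRel (H : Profunctor.{u} B A) (K : Profunctor.{u} C B) (a : A) (c : C) :
    (Σ b : B, el H a b × el K b c) → (Σ b : B, el H a b × el K b c) → Prop
  | mk {b b' : B} (g : b ⟶ b') (x : el H a b) (y : el K b' c) :
    CoendRel H K a c ⟨b', act H (𝟙 a) g x, y⟩ ⟨b, x, act K g (𝟙 c) y⟩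

/-- The coend `∫^b H(a, b) × K(b, c)`. -/
def Coend (H : Profunctor.{u} B A) (K : Profunctor.{u} C B) (a : A) (c : C) : Type u :=
  Quot (CoendRel H K a c)

/-- The functorial action on the coends `∫^b H(a, b) × K(b, c)`. -/
def Coend.map (H : Profunctor.{u} B A) (K : Profunctor.{u} C B) {a a' : A} {c c' : C}
    (f : a ⟶ a') (g : c ⟶ c') : Coend H K a' c → Coend H K a c' :=
  Quot.map (fun p => ⟨p.1, act H f (𝟙 _) p.2.1, act K (𝟙 _) g p.2.2⟩) (fun _ _ h => by
    obtain ⟨k, x, y⟩ := h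
    have h := CoendRel.mk (H := H) (K := K) k (act H f (𝟙 _) x) (act K (𝟙 _) g y)
    simpa using h)

/-- The composite of the profunctors `H` and `K`, with
`(a, c) ↦ ∫^b H(a, b) × K(b, c)`. -/
def comp (H : Profunctor.{u} B A) (K : Profunctor.{u} C B) : Profunctor.{u} C A :=
  ofAct (Coend H K) (Coend.map H K)
    (fun x => by obtain ⟨b, x, y⟩ := x; simp [Coend.map, Quot.map]; rfl)
    (fun f f' g g' x => by obtain ⟨b, x, y⟩ := x; simp [Coend.map, Quot.map]; rfl)

section

variable {H : Profunctor.{u} B A} {K : Profunctor.{u} C B} {a a' : A} {b b' : B} {c c' : C}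

/-- The class of a pair `(x, y) ∈ H(a, b) × K(b, c)` in the coend. -/
def mk (x : el H a b) (y : el K b c) : el (comp H K) a c :=
  Quot.mk (CoendRel H K a c) ⟨b, x, y⟩

theorem mk_act (g : b ⟶ b') (x : el H a b) (y : el K b' c) :
    mk (act H (𝟙 a) g x) y = mk x (act K g (𝟙 c) y) :=
  Quot.sound (CoendRel.mk g x y)

theorem ind {p : el (comp H K) a c → Prop}
    (h : ∀ (b : B) (x : el H a b) (y : el K b c), p (mk x y)) (z : el (comp H K) a c) : p z :=
  Quot.ind (β := p) (fun ⟨b, x, y⟩ => h b x y) z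

/-- The universal property of the coend. -/
def lift {S : Type u} (φ : ∀ b : B, el H a b → el K b c → S)
    (hφ : ∀ {b b' : B} (g : b ⟶ b') (x : el H a b) (y : el K b' c),
      φ b' (act H (𝟙 a) g x) y = φ b x (act K g (𝟙 c) y)) (z : el (comp H K) a c) : S :=
  Quot.lift (r := CoendRel H K a c) (fun p => φ p.1 p.2.1 p.2.2)
    (fun _ _ h => by cases h; exact hφ _ _ _) z

@[simp]
theorem lift_mk {S : Type u} (φ : ∀ b : B, el H a b → el K b c → S)
    (hφ : ∀ {b b' : B} (g : b ⟶ b') (x : el H a b) (y : el K b' c),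
      φ b' (act H (𝟙 a) g x) y = φ b x (act K g (𝟙 c) y)) (x : el H a b) (y : el K b c) :
    lift φ hφ (mk x y) = φ b x y := rfl

@[simp]
theorem act_mk (f : a ⟶ a') (g : c ⟶ c') (x : el H a' b) (y : el K b c) :
    act (comp H K) f g (mk x y) = mk (act H f (𝟙 b) x) (act K (𝟙 b) g y) := by
  change mk (act H (𝟙 a) (𝟙 b) (act H f (𝟙 b) x)) (act K (𝟙 b) g (act K (𝟙 b) (𝟙 c) y)) = _
  simp

end

/-- The hom-functor of `A`. -/
abbrev homProf (A : Type u) [Category.{u} A] : Profunctor.{u} A A := Profunctor.id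

/-- A morphism, as an element of the hom-functor. -/
def ofHom {a b : A} (f : a ⟶ b) : el (homProf A) a b := f

/-- An element of the hom-functor, as a morphism. -/
def toHom {a b : A} (x : el (homProf A) a b) : a ⟶ b := x

@[simp] theorem toHom_ofHom {a b : A} (f : a ⟶ b) : toHom (ofHom f) = f := rfl

@[simp] theorem ofHom_toHom {a b : A} (x : el (homProf A) a b) : ofHom (toHom x) = x := rfl

@[simp]
theorem toHom_act {a a' b b' : A} (f : a ⟶ a') (g : b ⟶ b') (x : el (homProf A) a' b) :
    toHom (act (homProf A) f g x) = f ≫ toHom x ≫ g := by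
  change (f ≫ toHom x) ≫ g = _
  simp

@[simp]
theorem act_ofHom {a a' b b' : A} (f : a ⟶ a') (g : b ⟶ b') (x : a' ⟶ b) :
    act (homProf A) f g (ofHom x) = ofHom (f ≫ x ≫ g) :=
  toHom_act f g (ofHom x)

variable {A' B' C' : Type u} [Category.{u} A'] [Category.{u} B'] [Category.{u} C']

/-- A square with top `H`, bottom `H'`, left side `F` and right side `G`: a natural family of
maps `H(a, b) → H'(F a, G b)`. -/
@[ext]
structure Square (H : Profunctor.{u} B A) (H' : Profunctor.{u} B' A') (F : A ⥤ A')
    (G : B ⥤ B') where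
  app : ∀ {a : A} {b : B}, el H a b → el H' (F.obj a) (G.obj b)
  naturality : ∀ {a a' : A} {b b' : B} (f : a ⟶ a') (g : b ⟶ b') (x : el H a' b),
    app (act H f g x) = act H' (F.map f) (G.map g) (app x)

/-- A square with identity vertical sides, from a natural family of maps
`H(a, b) → H'(a, b)`. -/
def Square.ofId {H H' : Profunctor.{u} B A} (app : ∀ {a : A} {b : B}, el H a b → el H' a b)
    (naturality : ∀ {a a' : A} {b b' : B} (f : a ⟶ a') (g : b ⟶ b') (x : el H a' b),
      app (act H f g x) = act H' f g (app x)) : Square H H' (𝟭 A) (𝟭 B) where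
  app := app
  naturality := naturality

/-- The action of a functor on morphisms, as a square between horizontal units. -/
def hidSquare (F : A ⥤ A') : Square (homProf A) (homProf A') F F where
  app x := ofHom (F.map (toHom x))
  naturality f g x := by simp

/-- Horizontal composition of squares. -/
def hcompSquare {H : Profunctor.{u} B A} {K : Profunctor.{u} C B} {H' : Profunctor.{u} B' A'}
    {K' : Profunctor.{u} C' B'} {F : A ⥤ A'} {G : B ⥤ B'} {L : C ⥤ C'}
    (α : Square H H' F G) (β : Square K K' G L) : Square (comp H K) (comp H' K') F L where
  app := lift (fun _ x y => mk (α.app x) (β.app y)) (fun k x y => by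
    rw [α.naturality, β.naturality]
    simpa using mk_act (G.map k) (α.app x) (β.app y))
  naturality f g z := by
    induction z using ind with
    | h b x y => simp [α.naturality, β.naturality]

section

variable (H : Profunctor.{u} B A) (K : Profunctor.{u} C B) (L : Profunctor.{u} E C)

/-- The associativity isomorphism `[[x, y], z] ↦ [x, [y, z]]`. -/
def assocSquare : Square (comp (comp H K) L) (comp H (comp K L)) (𝟭 A) (𝟭 E) :=
  .ofId (lift (fun c p z => lift (fun _ x y => mk x (mk y z)) (fun k x y => by
      simpa using mk_act k x (mk y z)) p)
    (fun k p z => by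
      induction p using ind with
      | h b x y => simp [mk_act])) (fun f g p => by
    induction p using ind with
    | h c p z =>
      induction p using ind with
      | h b x y => simp)

/-- The inverse associativity isomorphism. -/
def assocInvSquare : Square (comp H (comp K L)) (comp (comp H K) L) (𝟭 A) (𝟭 E) :=
  .ofId (lift (fun b x p => lift (fun _ y z => mk (mk x y) z) (fun k y z => by
      simpa using mk_act k (mk x y) z) p)
    (fun k x p => by
      induction p using ind with
      | h c y z => simp [mk_act]; rfl)) (fun f g p => by
    induction p using ind with
    | h c x p =>
      induction p using ind with
      | h b y z => simp)

/-- The unit isomorphism `[f, x] ↦ H(f, b)(x)`. -/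
def lunitSquare : Square (comp (homProf A) H) H (𝟭 A) (𝟭 B) :=
  .ofId (lift (fun a' f x => act H (toHom f) (𝟙 _) x) (fun k f x => by simp)) (fun f g p => by
    induction p using ind with
    | h a' k x => simp)

/-- The inverse unit isomorphism `x ↦ [id, x]`. -/
def lunitInvSquare : Square H (comp (homProf A) H) (𝟭 A) (𝟭 B) :=
  .ofId (fun x => mk (ofHom (𝟙 _)) x) (fun f g x => by
    have h := mk_act (H := homProf A) f (ofHom (𝟙 _)) (act H (𝟙 _) g x)
    simpa using h.symm)

/-- The unit isomorphism `[x, f] ↦ H(a, f)(x)`. -/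
def runitSquare : Square (comp H (homProf B)) H (𝟭 A) (𝟭 B) :=
  .ofId (lift (fun b' x f => act H (𝟙 _) (toHom f) x) (fun k f x => by simp)) (fun f g p => by
    induction p using ind with
    | h b' x k => simp)

/-- The inverse unit isomorphism `x ↦ [x, id]`. -/
def runitInvSquare : Square H (comp H (homProf B)) (𝟭 A) (𝟭 B) :=
  .ofId (fun x => mk x (ofHom (𝟙 _))) (fun f g x => by
    have h := mk_act (K := homProf B) g (act H f (𝟙 _) x) (ofHom (𝟙 _))
    simpa using h)

variable {H K L} {a : A} {b : B} {c : C} {e : E}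

@[simp] theorem assocSquare_app (x : el H a b) (y : el K b c) (z : el L c e) :
    (assocSquare H K L).app (mk (mk x y) z) = mk x (mk y z) := rfl

@[simp] theorem assocInvSquare_app (x : el H a b) (y : el K b c) (z : el L c e) :
    (assocInvSquare H K L).app (mk x (mk y z)) = mk (mk x y) z := rfl

@[simp] theorem lunitSquare_app {a' : A} (f : el (homProf A) a a') (x : el H a' b) :
    (lunitSquare H).app (mk f x) = act H (toHom f) (𝟙 b) x := rfl

@[simp] theorem lunitInvSquare_app (x : el H a b) :
    (lunitInvSquare H).app x = mk (ofHom (𝟙 a)) x := rfl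

@[simp] theorem runitSquare_app {b' : B} (x : el H a b) (f : el (homProf B) b b') :
    (runitSquare H).app (mk x f) = act H (𝟙 a) (toHom f) x := rfl

@[simp] theorem runitInvSquare_app (x : el H a b) :
    (runitInvSquare H).app x = mk x (ofHom (𝟙 b)) := rfl

theorem mk_ofHom_act {a' : A} (f : a ⟶ a') (x : el H a' b) :
    mk (ofHom (𝟙 a)) (act H f (𝟙 b) x) = mk (ofHom f) x := by
  have h := mk_act (H := homProf A) f (ofHom (𝟙 a)) x
  simpa using h.symm

theorem mk_act_ofHom {b' : B} (f : b ⟶ b') (x : el H a b) :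
    mk (act H (𝟙 a) f x) (ofHom (𝟙 b')) = mk x (ofHom f) := by
  have h := mk_act (K := homProf B) f x (ofHom (𝟙 b'))
  simpa using h

end

end

/-- The data of the pseudo double category of profunctors: see `PROFop`. -/
def struct : DoubleStruct.{u + 1, u, u + 1, u} where
  Obj := Cat.{u, u}
  vert := Cat.category
  Hor A B := Profunctor.{u} B A
  Sq H H' F G := Square H H' (Cat.Hom.toFunctor F) (Cat.Hom.toFunctor G)
  sqId H := { app := fun x => x, naturality := fun _ _ _ => rfl }
  sqComp α β :=
    { app := fun x => β.app (α.app x)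
      naturality := fun f g x => by
        rw [α.naturality, β.naturality]; rfl }
  hid A := homProf A
  hidSq F := hidSquare (Cat.Hom.toFunctor F)
  hcomp H K := comp H K
  hcompSq α β := hcompSquare α β

theorem struct_sqEq {A B A' B' : Cat.{u, u}} {H : Profunctor.{u} B A} {H' : Profunctor.{u} B' A'}
    {F : A ⟶ A'} {G : B ⟶ B'} {α β : Square H H' (Cat.Hom.toFunctor F) (Cat.Hom.toFunctor G)}
    (h : ∀ (a : A) (b : B) (x : el H a b), α.app x = β.app x) :
    @DoubleStruct.SqEq struct.{u} A B A' B' H H' F F G G α β :=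
  .of_eq (D := struct.{u}) (Square.ext (by funext a b x; exact h a b x))

/-- The pseudo double category `ℙROFᵒᵖ` of large categories, functors and profunctors, with its
horizontal direction reversed. A horizontal morphism from `A` to `B` is a functor
`Aᵒᵖ × B → SET`, that is a profunctor from `B` to `A`; horizontal units are the hom-functors;
the composite of `H` followed by `K` is `(a, c) ↦ ∫^b H(a, b) × K(b, c)`.
Large sets are the types in `Type u`. -/
def _root_.PROFop : PseudoDoubleCategory.{u + 1, u, u + 1, u} where
  toDoubleStruct := struct.{u}
  id_sqComp _ := .refl _
  sqComp_id _ := .refl _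
  sqComp_assoc _ _ _ := .refl _
  hidSq_id A := Square.ext rfl
  hidSq_comp f g := Square.ext rfl
  hcompSq_id X Y := Square.ext (by
    funext a b z
    induction z using ind
    rfl)
  hcompSq_comp α β α' β' := Square.ext (by
    funext a b z
    induction z using ind
    rfl)
  assoc := @fun (A B C E : Cat.{u, u}) (X : Profunctor.{u} B A) (Y : Profunctor.{u} C B)
    (Z : Profunctor.{u} E C) => assocSquare X Y Z
  assocInv := @fun (A B C E : Cat.{u, u}) (X : Profunctor.{u} B A) (Y : Profunctor.{u} C B)
    (Z : Profunctor.{u} E C) => assocInvSquare X Y Z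
  assoc_assocInv X Y Z := struct_sqEq (fun a b z => by
    induction z using ind with
    | h c p z =>
      induction p using ind
      rfl)
  assocInv_assoc X Y Z := struct_sqEq (fun a b z => by
    induction z using ind with
    | h c x p =>
      induction p using ind
      rfl)
  assoc_naturality α β γ := struct_sqEq (fun a b z => by
    induction z using ind with
    | h c p z =>
      induction p using ind
      rfl)
  lunit := @fun (A B : Cat.{u, u}) (X : Profunctor.{u} B A) => lunitSquare X
  lunitInv := @fun (A B : Cat.{u, u}) (X : Profunctor.{u} B A) => lunitInvSquare X
  lunit_lunitInv := @fun (A B : Cat.{u, u}) (X : Profunctor.{u} B A) => struct_sqEq (fun a b z => by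
    induction z using ind with
    | h a' f x => exact mk_ofHom_act (toHom f) x)
  lunitInv_lunit := @fun (A B : Cat.{u, u}) (X : Profunctor.{u} B A) => struct_sqEq (fun a b x => act_id _ x)
  lunit_naturality := @fun (A B A' B' : Cat.{u, u}) (X : Profunctor.{u} B A)
    (X' : Profunctor.{u} B' A') (F : A ⟶ A') (G : B ⟶ B')
    (α : Square X X' (Cat.Hom.toFunctor F) (Cat.Hom.toFunctor G)) => struct_sqEq (fun a b z => by
    induction z using ind with
    | h a' f x =>
      refine Eq.trans ?_ (Square.naturality α (toHom f) (𝟙 b) x).symm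
      exact congr_arg (fun k => act X' ((Cat.Hom.toFunctor F).map (toHom f)) k (α.app x))
        ((Cat.Hom.toFunctor G).map_id b).symm)
  runit := @fun (A B : Cat.{u, u}) (X : Profunctor.{u} B A) => runitSquare X
  runitInv := @fun (A B : Cat.{u, u}) (X : Profunctor.{u} B A) => runitInvSquare X
  runit_runitInv := @fun (A B : Cat.{u, u}) (X : Profunctor.{u} B A) => struct_sqEq (fun a b z => by
    induction z using ind with
    | h b' x f => exact mk_act_ofHom (toHom f) x)
  runitInv_runit := @fun (A B : Cat.{u, u}) (X : Profunctor.{u} B A) => struct_sqEq (fun a b x => act_id _ x)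
  runit_naturality := @fun (A B A' B' : Cat.{u, u}) (X : Profunctor.{u} B A)
    (X' : Profunctor.{u} B' A') (F : A ⟶ A') (G : B ⟶ B')
    (α : Square X X' (Cat.Hom.toFunctor F) (Cat.Hom.toFunctor G)) => struct_sqEq (fun a b z => by
    induction z using ind with
    | h b' x f =>
      refine Eq.trans ?_ (Square.naturality α (𝟙 a) (toHom f) x).symm
      exact congr_arg (fun k => act X' k ((Cat.Hom.toFunctor G).map (toHom f)) (α.app x))
        ((Cat.Hom.toFunctor F).map_id a).symm)
  pentagon W X Y Z := struct_sqEq (fun a b z => by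
    induction z using ind with
    | h c p z =>
      induction p using ind with
      | h d p y =>
        induction p using ind
        rfl)
  triangle := @fun (A B C : Cat.{u, u}) (X : Profunctor.{u} B A) (Y : Profunctor.{u} C B) =>
    struct_sqEq (fun a b z => by
    induction z using ind with
    | h c p z =>
      induction p using ind with
      | h d x f => exact (mk_act (toHom f) x z).symm)

end ProfOp

/-! ### Metamodels and models -/

section

open ProfOp

/-- The component `H(a, b) → H'(a, b)` of a natural transformation between profunctors. -/
def ProfOp.natApp {A B : Type u} [Category.{u} A] [Category.{u} B] {H H' : Profunctor.{u} B A}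
    (τ : H ⟶ H') {a : A} {b : B} (x : el H a b) : el H' a b :=
  (τ.app b).app (op a) x

theorem ProfOp.natApp_act {A B : Type u} [Category.{u} A] [Category.{u} B]
    {H H' : Profunctor.{u} B A} (τ : H ⟶ H') {a a' : A} {b b' : B} (f : a ⟶ a') (g : b ⟶ b')
    (x : el H a' b) : natApp τ (act H f g x) = act H' f g (natApp τ x) := by
  have key : ∀ x : (H.obj b).obj (op a'),
      (τ.app b').app (op a) ((H.map g).app (op a) ((H.obj b).map f.op x)) =
        (H'.map g).app (op a) ((H'.obj b).map f.op ((τ.app b).app (op a') x)) := fun x => by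
    have h₁ := congr_fun (congr_arg (fun k => (ConcreteCategory.hom k : _ → _))
      ((τ.app b).naturality f.op)) x
    have h₂ := congr_fun (congr_arg (fun k => (ConcreteCategory.hom (k.app (op a)) : _ → _))
      (τ.naturality g)) ((H.obj b).map f.op x)
    simp only [NatTrans.comp_app, ConcreteCategory.comp_apply] at h₁ h₂
    rw [h₂, h₁]
  exact key x

@[simp]
theorem ProfOp.natApp_id {A B : Type u} [Category.{u} A] [Category.{u} B]
    (H : Profunctor.{u} B A) {a : A} {b : B} (x : el H a b) : natApp (𝟙 H) x = x := rfl

theorem ProfOp.natApp_comp {A B : Type u} [Category.{u} A] [Category.{u} B]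
    {H H' H'' : Profunctor.{u} B A} (σ : H ⟶ H') (τ : H' ⟶ H'') {a : A} {b : B} (x : el H a b) :
    natApp (σ ≫ τ) x = natApp τ (natApp σ x) := rfl

variable (M : Type u₁) [Category.{v₁} M] [MonoidalCategory M] (C : Type u) [Category.{u} C]

/-- A metamodel of the monoidal category `M` in the category `C`: a functor
`Φ : Mᵒᵖ × Cᵒᵖ × C → SET`, written `(X, a, b) ↦ Φ_X(a, b)`, with natural families of elements
`unit c ∈ Φ_I(c, c)` and of maps `mul : Φ_Y(b, c) × Φ_X(a, b) → Φ_{Y ⊗ X}(a, c)` that are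
unital and associative. The functor is given in curried form, and `natApp (functor.map s.op)` is
the map `Φ_s : Φ_X(a, b) → Φ_{X'}(a, b)` for `s : X' ⟶ X`. -/
structure Metamodel where
  functor : Mᵒᵖ ⥤ Profunctor.{u} C C
  unit : ∀ c : C, el (functor.obj (op (𝟙_ M))) c c
  unit_naturality : ∀ {c c' : C} (f : c ⟶ c'),
    act _ (𝟙 c) f (unit c) = act _ f (𝟙 c') (unit c')
  mul : ∀ {X Y : M} {a b c : C}, el (functor.obj (op Y)) b c → el (functor.obj (op X)) a b →
    el (functor.obj (op (Y ⊗ X))) a c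
  /- naturality in `a` and `c` -/
  mul_act : ∀ {X Y : M} {a a' b c c' : C} (f : a ⟶ a') (g : c ⟶ c')
    (y : el (functor.obj (op Y)) b c) (x : el (functor.obj (op X)) a' b),
    mul (act _ (𝟙 b) g y) (act _ f (𝟙 b) x) = act _ f g (mul y x)
  /- naturality in `b` -/
  mul_dinatural : ∀ {X Y : M} {a b b' c : C} (k : b ⟶ b')
    (y : el (functor.obj (op Y)) b' c) (x : el (functor.obj (op X)) a b),
    mul (act _ k (𝟙 c) y) x = mul y (act _ (𝟙 a) k x)
  /- naturality in `X` and `Y` -/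
  mul_naturality : ∀ {X X' Y Y' : M} (s : X' ⟶ X) (t : Y' ⟶ Y) {a b c : C}
    (y : el (functor.obj (op Y)) b c) (x : el (functor.obj (op X)) a b),
    mul (natApp (functor.map t.op) y) (natApp (functor.map s.op) x) =
      natApp (functor.map (t ⊗ₘ s).op) (mul y x)
  unit_mul : ∀ {X : M} {a b : C} (x : el (functor.obj (op X)) a b),
    mul (unit b) x = natApp (functor.map (λ_ X).hom.op) x
  mul_unit : ∀ {X : M} {a b : C} (x : el (functor.obj (op X)) a b),
    mul x (unit a) = natApp (functor.map (ρ_ X).hom.op) x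
  mul_assoc : ∀ {X Y Z : M} {a b c d : C} (z : el (functor.obj (op Z)) c d)
    (y : el (functor.obj (op Y)) b c) (x : el (functor.obj (op X)) a b),
    mul (mul z y) x = natApp (functor.map (α_ Z Y X).hom.op) (mul z (mul y x))

variable {M C}

/-- A model of the theory `T`, a monoid object of `M`, with respect to a metamodel. -/
structure Model (T : Mon M) (Φ : Metamodel M C) where
  carrier : C
  str : el (Φ.functor.obj (op T.X)) carrier carrier
  str_one : natApp (Φ.functor.map (MonObj.one (X := T.X)).op) str = Φ.unit carrier
  str_mul : natApp (Φ.functor.map (MonObj.mul (X := T.X)).op) str = Φ.mul str str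

/-- A homomorphism of models. -/
@[ext]
structure Model.Hom {T : Mon M} {Φ : Metamodel M C} (p q : Model T Φ) where
  hom : p.carrier ⟶ q.carrier
  act_hom : act _ (𝟙 _) hom p.str = act _ hom (𝟙 _) q.str

/-- The category of models of `T` with respect to `Φ`. -/
instance Model.category {T : Mon M} {Φ : Metamodel M C} : Category.{u} (Model T Φ) where
  Hom p q := Model.Hom p q
  id p := ⟨𝟙 _, rfl⟩
  comp f g := ⟨f.hom ≫ g.hom, by
    have h₁ := congr_arg (act _ (𝟙 _) g.hom) f.act_hom
    have h₂ := congr_arg (act _ f.hom (𝟙 _)) g.act_hom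
    simp only [act_act, Category.comp_id, Category.id_comp] at h₁ h₂
    rw [h₁, h₂]⟩
  id_comp f := Model.Hom.ext (Category.id_comp f.hom)
  comp_id f := Model.Hom.ext (Category.comp_id f.hom)
  assoc f g h := Model.Hom.ext (Category.assoc f.hom g.hom h.hom)

/-- The forgetful functor from models to `C`. -/
def Model.forget (T : Mon M) (Φ : Metamodel M C) : Model T Φ ⥤ C where
  obj p := p.carrier
  map f := f.hom
  map_id _ := rfl
  map_comp _ _ := rfl

section

variable (Φ : Metamodel M C)

theorem Metamodel.natApp_inv_hom {X Y : M} (e : X ≅ Y) {a b : C}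
    (x : el (Φ.functor.obj (op Y)) a b) :
    natApp (Φ.functor.map e.inv.op) (natApp (Φ.functor.map e.hom.op) x) = x := by
  rw [← natApp_comp, ← Functor.map_comp, ← op_comp, e.inv_hom_id]
  simp

theorem Metamodel.natApp_map_id {X : Mᵒᵖ} {a b : C} (x : el (Φ.functor.obj X) a b) :
    natApp (Φ.functor.map (𝟙 X)) x = x := by
  simp

theorem Metamodel.natApp_map_comp {X Y Z : Mᵒᵖ} (s : X ⟶ Y) (t : Y ⟶ Z) {a b : C}
    (x : el (Φ.functor.obj X) a b) :
    natApp (Φ.functor.map (s ≫ t)) x = natApp (Φ.functor.map t) (natApp (Φ.functor.map s) x) := by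
  rw [Functor.map_comp, natApp_comp]

theorem Metamodel.mul_act_unit {X : M} {a b c : C} (f : a ⟶ b)
    (x : el (Φ.functor.obj (op X)) b c) :
    natApp (Φ.functor.map (ρ_ X).inv.op) (Φ.mul x (act _ (𝟙 a) f (Φ.unit a))) =
      act _ f (𝟙 c) x := by
  rw [← Φ.mul_dinatural, Φ.mul_unit]
  exact Φ.natApp_inv_hom (ρ_ X) _

theorem Metamodel.act_unit_mul {X : M} {a b c : C} (f : b ⟶ c)
    (x : el (Φ.functor.obj (op X)) a b) :
    natApp (Φ.functor.map (λ_ X).inv.op) (Φ.mul (act _ (𝟙 b) f (Φ.unit b)) x) =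
      act _ (𝟙 a) f x := by
  rw [Φ.unit_naturality, Φ.mul_dinatural, Φ.unit_mul]
  exact Φ.natApp_inv_hom (λ_ X) _

/-- The action of a metamodel on a morphism of `M`, as a square. -/
def Metamodel.mapSquare {X Y : Mᵒᵖ} (s : X ⟶ Y) :
    Square (Φ.functor.obj X) (Φ.functor.obj Y) (𝟭 C) (𝟭 C) :=
  .ofId (fun x => natApp (Φ.functor.map s) x) (fun f g x => natApp_act _ f g x)

/-- The unit of a metamodel, as a square. -/
def Metamodel.unitSquare :
    Square (homProf C) (Φ.functor.obj (op (𝟙_ M))) (𝟭 C) (𝟭 C) :=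
  .ofId (fun f => act _ (𝟙 _) (toHom f) (Φ.unit _)) (fun {a a' b b'} f g x => by
    have h := congr_arg (act _ (𝟙 a) (toHom x ≫ g)) (Φ.unit_naturality f)
    simpa using h)

/-- The multiplication of a metamodel, as a square. -/
def Metamodel.mulSquare (X Y : Mᵒᵖ) :
    Square (comp (Φ.functor.obj X) (Φ.functor.obj Y)) (Φ.functor.obj (op (unop Y ⊗ unop X)))
      (𝟭 C) (𝟭 C) :=
  .ofId (lift (fun b x y => Φ.mul y x) (fun k x y => (Φ.mul_dinatural k y x).symm))
    (fun f g x => by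
      induction x using ProfOp.ind with
      | h b x y =>
        rw [act_mk]
        exact Φ.mul_act f g y x)

end

/-- A metamodel, as a lax double functor. -/
def Metamodel.lax (Φ : Metamodel M C) : LaxDoubleFunctor (HSigma Mᵒᵖ) PROFop.{u} where
  vert := (Functor.const (Discrete PUnit.{1})).obj (Cat.of C)
  hor X := Φ.functor.obj X
  sq s := Φ.mapSquare s
  sq_id X := struct_sqEq (A := Cat.of C) (B := Cat.of C) (fun a b x => Φ.natApp_map_id x)
  sq_comp s t := struct_sqEq (A := Cat.of C) (B := Cat.of C) (fun a b x => 
    Φ.natApp_map_comp s t x)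
  unit _ := Φ.unitSquare
  unit_naturality _ := struct_sqEq (A := Cat.of C) (B := Cat.of C) (fun a b x => 
    (Φ.natApp_map_id _).symm)
  mul X Y := Φ.mulSquare X Y
  mul_naturality s t := struct_sqEq (A := Cat.of C) (B := Cat.of C) (fun a b x => by
    induction x using ProfOp.ind with
    | h b x y => exact Φ.mul_naturality (Quiver.Hom.unop s) (Quiver.Hom.unop t) y x)
  mul_assoc X Y Z := struct_sqEq (A := Cat.of C) (B := Cat.of C) (fun a b x => by
    induction x using ProfOp.ind with
    | h b x z =>
      induction x using ProfOp.ind with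
      | h b x y => exact (Φ.mul_assoc z y x).symm)
  unit_mul X := struct_sqEq (A := Cat.of C) (B := Cat.of C) (fun a b x => by
    induction x using ProfOp.ind with
    | h b f x => exact Φ.mul_act_unit (toHom f) x)
  mul_unit X := struct_sqEq (A := Cat.of C) (B := Cat.of C) (fun a b x => by
    induction x using ProfOp.ind with
    | h b x f => exact Φ.act_unit_mul (toHom f) x)

/-- The canonical square `u` from the hom-functor of the category of models to `Φ_T`, which maps
`f : (c, ξ) ⟶ (c', ξ')` to `Φ_T(c, f)(ξ) = Φ_T(f, c')(ξ')`. -/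
def Model.square (T : Mon M) (Φ : Metamodel M C) :
    Square (homProf (Model T Φ)) (Φ.functor.obj (op T.X)) (Model.forget T Φ)
      (Model.forget T Φ) where
  app {p q} f := act _ (𝟙 _) (toHom f).hom p.str
  naturality {p p' q q'} f g x := by
    have h := congr_arg (act _ (𝟙 p.carrier) ((toHom x).hom ≫ g.hom)) f.act_hom
    rw [toHom_act]
    change act _ _ (f.hom ≫ (toHom x).hom ≫ g.hom) _ =
      act _ f.hom g.hom (act _ (𝟙 _) (toHom x).hom p'.str)
    simp only [act_act, Category.id_comp, Category.comp_id] at h ⊢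
    exact h

end

/-! ### The augmented simplex category -/

/-- The augmented simplex category `Δ_a`: its objects are the finite ordinals
`n = {0 < 1 < ⋯ < n - 1}`, including `0`, and its morphisms are the monotone maps. -/
structure DeltaA where
  len : ℕ

namespace DeltaA

/-- A monotone map between finite ordinals. -/
@[ext]
structure Hom (m n : DeltaA) where
  map : Fin m.len → Fin n.len
  monotone : Monotone map

instance : Category.{0} DeltaA where
  Hom m n := Hom m n
  id _ := ⟨id, monotone_id⟩
  comp f g := ⟨g.map ∘ f.map, g.monotone.comp f.monotone⟩

@[simp] theorem id_map (m : DeltaA) (i : Fin m.len) : Hom.map (𝟙 m) i = i := rfl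

@[simp] theorem comp_map {m n k : DeltaA} (f : m ⟶ n) (g : n ⟶ k) (i : Fin m.len) :
    (f ≫ g).map i = g.map (f.map i) := rfl

theorem hom_ext {m n : DeltaA} {f g : m ⟶ n} (h : ∀ i, (f.map i).val = (g.map i).val) : f = g :=
  Hom.ext (funext fun i => Fin.ext (h i))

/-- The isomorphism between equal ordinals. -/
def castIso {m n : DeltaA} (h : m.len = n.len) : m ≅ n where
  hom := ⟨Fin.cast h, fun _ _ hij => hij⟩
  inv := ⟨Fin.cast h.symm, fun _ _ hij => hij⟩
  hom_inv_id := rfl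
  inv_hom_id := rfl

@[simp] theorem castIso_hom_map {m n : DeltaA} (h : m.len = n.len) (i : Fin m.len) :
    (castIso h).hom.map i = Fin.cast h i := rfl

/-- The ordinal sum of two monotone maps: it is `f` on the first summand and `g` on the
second. -/
def sumHom {m n m' n' : DeltaA} (f : m ⟶ n) (g : m' ⟶ n') :
    (⟨m.len + m'.len⟩ : DeltaA) ⟶ ⟨n.len + n'.len⟩ where
  map := Fin.addCases (fun i => Fin.castAdd n'.len (f.map i))
    (fun j => Fin.natAdd n.len (g.map j))
  monotone i j := by
    induction i using Fin.addCases with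
    | left i =>
      induction j using Fin.addCases with
      | left j =>
        intro h
        have h' : f.map i ≤ f.map j := f.monotone h
        simp only [Fin.addCases_left]
        exact h'
      | right j =>
        intro _
        simp [Fin.le_def]
        omega
    | right i =>
      induction j using Fin.addCases with
      | left j =>
        intro h
        simp [Fin.le_def] at h
        omega
      | right j => simpa using fun h => g.monotone h

@[simp] theorem sumHom_castAdd {m n m' n' : DeltaA} (f : m ⟶ n) (g : m' ⟶ n') (i : Fin m.len) :
    (sumHom f g).map (Fin.castAdd m'.len i) = Fin.castAdd n'.len (f.map i) := by
  simp [sumHom]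

@[simp] theorem sumHom_natAdd {m n m' n' : DeltaA} (f : m ⟶ n) (g : m' ⟶ n') (i : Fin m'.len) :
    (sumHom f g).map (Fin.natAdd m.len i) = Fin.natAdd n.len (g.map i) := by
  simp [sumHom]

theorem sum_ext {m m' n : DeltaA} {f g : (⟨m.len + m'.len⟩ : DeltaA) ⟶ n}
    (h₁ : ∀ i, (f.map (Fin.castAdd m'.len i)).val = (g.map (Fin.castAdd m'.len i)).val)
    (h₂ : ∀ i, (f.map (Fin.natAdd m.len i)).val = (g.map (Fin.natAdd m.len i)).val) : f = g :=
  hom_ext fun i => by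
    induction i using Fin.addCases with
    | left i => exact h₁ i
    | right i => exact h₂ i

theorem sumHom_id (m n : DeltaA) : sumHom (𝟙 m) (𝟙 n) = 𝟙 _ :=
  sum_ext (by simp) (by simp)

theorem sumHom_comp {m n k m' n' k' : DeltaA} (f : m ⟶ n) (g : n ⟶ k) (f' : m' ⟶ n')
    (g' : n' ⟶ k') : sumHom (f ≫ g) (f' ≫ g') = sumHom f f' ≫ sumHom g g' :=
  sum_ext (by simp) (by simp)

theorem sumHom_val {m n m' n' : DeltaA} (f : m ⟶ n) (g : m' ⟶ n') (i : Fin (m.len + m'.len)) :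
    ((sumHom f g).map i).val = if h : i.val < m.len then (f.map ⟨i, h⟩).val
      else n.len + (g.map ⟨i - m.len, by omega⟩).val := by
  induction i using Fin.addCases with
  | left i => simp
  | right i => simp

instance : MonoidalCategory DeltaA where
  tensorObj m n := ⟨m.len + n.len⟩
  tensorUnit := ⟨0⟩
  tensorHom f g := sumHom f g
  whiskerLeft m _ _ g := sumHom (𝟙 m) g
  whiskerRight f m := sumHom f (𝟙 m)
  associator _ _ _ := castIso (Nat.add_assoc _ _ _)
  leftUnitor _ := castIso (Nat.zero_add _)
  rightUnitor _ := castIso (Nat.add_zero _)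
  tensorHom_def f g := by rw [← sumHom_comp, Category.comp_id, Category.id_comp]
  id_tensorHom_id := sumHom_id
  tensorHom_comp_tensorHom f g f' g' := (sumHom_comp _ _ _ _).symm
  whiskerLeft_id := sumHom_id
  id_whiskerRight := sumHom_id
  associator_naturality f g h := hom_ext fun i => by
    simp only [comp_map, castIso_hom_map, Fin.val_cast, sumHom_val]
    grind
  leftUnitor_naturality f := hom_ext fun i => by
    simp only [comp_map, castIso_hom_map, Fin.val_cast, sumHom_val]
    simp
    rfl
  rightUnitor_naturality f := hom_ext fun i => by
    simp only [comp_map, castIso_hom_map, Fin.val_cast, sumHom_val]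
    have := i.isLt
    simp_all
  pentagon _ _ _ _ := hom_ext fun i => by
    simp only [comp_map, castIso_hom_map, Fin.val_cast, sumHom_val, id_map]
    split_ifs <;> simp_all <;> omega
  triangle _ _ := hom_ext fun i => by
    simp only [comp_map, castIso_hom_map, Fin.val_cast, sumHom_val, id_map]
    split_ifs <;> simp_all

/-- The ordinal `1`. -/
def one : DeltaA := ⟨1⟩

instance (m : DeltaA) : Unique (m ⟶ one) where
  default := ⟨fun _ => (0 : Fin 1), fun _ _ _ => le_rfl⟩
  uniq _ := Hom.ext (funext fun _ => Subsingleton.elim (α := Fin 1) _ _)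

/-- The unique monoid structure on the terminal object `1`. -/
instance : MonObj one where
  one := default
  mul := default
  one_mul := Subsingleton.elim _ _
  mul_one := Subsingleton.elim _ _
  mul_assoc := Subsingleton.elim _ _

end DeltaA

/-- The lax double functor `Φ(F) : ℍΣ(Δ_aᵒᵖ) → ℙROFᵒᵖ`: the composite of
`ℍΣ(Fᵒᵖ) : ℍΣ(Δ_aᵒᵖ) → ℍΣ(Mᵒᵖ)`, for a strong monoidal functor `F : Δ_a → M`, and the metamodel
`Φ : ℍΣ(Mᵒᵖ) → ℙROFᵒᵖ`. -/
def Metamodel.diagram {M : Type u₁} [Category.{v₁} M] [MonoidalCategory M] {C : Type u}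
    [Category.{u} C] (Φ : Metamodel M C) (F : DeltaA ⥤ M) [F.Monoidal] :
    LaxDoubleFunctor (HSigma DeltaAᵒᵖ) PROFop.{u} :=
  (HSigma.map F.op).comp Φ.lax

/-- The monoid object of `M` that corresponds to a strong monoidal functor `F : Δ_a → M`: the
image of the monoid object `1` of `Δ_a`. -/
def DeltaA.toMon {M : Type u₁} [Category.{v₁} M] [MonoidalCategory M] (F : DeltaA ⥤ M)
    [F.Monoidal] : Mon M :=
  F.mapMon.obj (Mon.mk DeltaA.one)

/-- The square `u` of `Model.square`, followed by the map `Φ_T → Φ_X` induced by a morphism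
`s : X ⟶ T` of `M`, as a square of `ℙROFᵒᵖ`. -/
def Model.squareComp {M : Type u₁} [Category.{v₁} M] [MonoidalCategory M] {C : Type u}
    [Category.{u} C] (T : Mon M) (Φ : Metamodel M C) {X : M} (s : X ⟶ T.X) :
    PROFop.{u}.Sq (A := Cat.of (Model T Φ)) (B := Cat.of (Model T Φ)) (A' := Cat.of C)
      (B' := Cat.of C) (PROFop.{u}.hid (Cat.of (Model T Φ))) (Φ.functor.obj (op X))
      (Model.forget T Φ).toCatHom (Model.forget T Φ).toCatHom :=
  PROFop.{u}.sqComp (A := Cat.of (Model T Φ)) (B := Cat.of (Model T Φ)) (A' := Cat.of C)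
      (B' := Cat.of C) (A'' := Cat.of C) (B'' := Cat.of C) (X := ProfOp.homProf (Model T Φ))
      (Y := Φ.functor.obj (op T.X)) (Z := Φ.functor.obj (op X))
      (f := (Model.forget T Φ).toCatHom) (g := (Model.forget T Φ).toCatHom)
      (f' := 𝟙 (Cat.of C)) (g' := 𝟙 (Cat.of C))
    (Model.square T Φ) (Φ.mapSquare s.op)

/-! ### Decomposition of monotone maps along an ordinal sum of their codomain -/

namespace DeltaA

/-! Existence of `F`. Put `F(n) = T^n`. A monotone map into an ordinal sum is in exactly one way an
ordinal sum of monotone maps (`exists_eq_sumHom`, `sumHom_injective`), because the preimage of an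
initial segment is an initial segment. Splitting the codomain `n` into copies of `1` thus cuts `f :
m ⟶ n` into blocks, and `F(f)` multiplies the factors inside each block. Uniqueness of the cut makes
this well defined. Functoriality and strong monoidality then come from general associativity, in the
form `powerAdd_mulPower` and `powerMap_mulPower`.

Double limit. The ordinal `1` is terminal in `Δ_a`, so naturality of a cone over `Φ(F)` forces its
square at `n` to be its square at `1` followed by `Φ` of `F(n) ⟶ F(1)`. A cone with vertex `A` is
therefore a functor `G : A ⥤ C` with one natural family `A(a, b) → Φ_{F(1)}(G a, G b)`. By Yoneda
this family amounts to its values at identities, that is, to elements `ξ_a` of `Φ_{F(1)}(G a, G a)`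
for which every `G f` satisfies the homomorphism equation. Compatibility with the horizontal unit,
and with the composite of `1` and `1`, gives the two model axioms once `F(1)` is identified with
`T`. Conversely the model axioms give compatibility at all ordinals, because the maps `0 ⟶ 1` and `m
+ n ⟶ 1` factor through the monoid structure of `1` (`fromOne_unit`, `fromOne_tensor`). So cones
with vertex `A` are functors from `A` to the category of models.

For a modification `θ` the equation at `1` says that each `θ(h)` is a homomorphism of models. Since
a homomorphism is a morphism of `C` with a property, `θ` lifts uniquely to the hom-functor of the
category of models. -/

theorem eqToHom_map_val {m n : DeltaA} (h : m = n) (i : Fin m.len) :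
    ((eqToHom h).map i).val = i.val := by
  subst h; rfl

theorem castIso_hom_eq_eqToHom {m n : DeltaA} (h : m = n) :
    (castIso (congrArg len h)).hom = eqToHom h := by
  subst h; rfl

theorem eq_of_hom_zero {m : DeltaA} (f : m ⟶ ⟨0⟩) : m = ⟨0⟩ := by
  obtain ⟨_ | m⟩ := m
  · rfl
  · exact (f.map 0).elim0

/-- An initial segment of a finite ordinal is determined by its length. -/
theorem exists_lt_iff_val_lt {m : ℕ} (p : Fin m → Prop) (hp : ∀ i j, i ≤ j → p j → p i) :
    ∃ k ≤ m, ∀ i : Fin m, p i ↔ i.val < k := by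
  classical
  by_cases h : ∃ k, ∃ hk : k < m, ¬ p ⟨k, hk⟩
  · refine ⟨Nat.find h, (Nat.find_spec h).1.le, fun i => ⟨fun hi => ?_, fun hi => ?_⟩⟩
    · by_contra hlt
      exact (Nat.find_spec h).2 (hp _ i (Fin.le_def.2 (not_lt.1 hlt)) hi)
    · by_contra hpi
      exact Nat.find_min h hi ⟨i.2, hpi⟩
  · push Not at h
    exact ⟨m, le_rfl, fun i => ⟨fun _ => i.2, fun _ => h i.1 i.2⟩⟩

/-- Every monotone map to an ordinal sum is an ordinal sum of monotone maps. -/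
theorem exists_eq_sumHom {m n n' : DeltaA} (f : m ⟶ ⟨n.len + n'.len⟩) :
    ∃ (k k' : DeltaA) (g : k ⟶ n) (g' : k' ⟶ n') (h : m = ⟨k.len + k'.len⟩),
      f = eqToHom h ≫ sumHom g g' := by
  -- The cut `k` is the length of the preimage of the first summand, an initial segment by
  -- monotonicity.
  obtain ⟨k, hk, hf⟩ := exists_lt_iff_val_lt (fun i => (f.map i).val < n.len)
    (fun i j hij hj => lt_of_le_of_lt (Fin.le_def.1 (f.monotone hij)) hj)
  have hm : m.len = k + (m.len - k) := by omega
  have hk' (i : Fin (m.len - k)) : k + i.1 < m.len := by omega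
  refine ⟨⟨k⟩, ⟨m.len - k⟩,
    ⟨fun i : Fin k => ⟨(f.map ⟨i.1, i.2.trans_le hk⟩).val, (hf _).2 i.2⟩, ?_⟩,
    ⟨fun i : Fin (m.len - k) => ⟨(f.map ⟨k + i.1, hk' i⟩).val - n.len, ?_⟩, ?_⟩,
    congrArg DeltaA.mk hm, ?_⟩
  · intro i j hij
    exact f.monotone (Fin.mk_le_mk.2 hij)
  · have h₁ := (f.map ⟨k + i.1, hk' i⟩).2
    have h₂ := hf ⟨k + i.1, hk' i⟩
    dsimp only at h₁ h₂
    omega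
  · intro i j hij
    have h : (f.map ⟨k + i.1, hk' i⟩).val ≤ (f.map ⟨k + j.1, hk' j⟩).val :=
      f.monotone (Fin.mk_le_mk.2 (Nat.add_le_add_left hij k))
    exact Fin.mk_le_mk.2 (Nat.sub_le_sub_right h _)
  · refine hom_ext fun i => ?_
    rw [comp_map, sumHom_val]
    simp only [eqToHom_map_val]
    have h₂ := hf i
    split_ifs with hi
    · rfl
    · have : (⟨k + (i.val - k), by omega⟩ : Fin m.len) = i := Fin.ext (by dsimp only; omega)
      simp only [this]
      omega

/-- If `l` were longer than `k`, the point at position `k.len` would lie in the second block on one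
side and in the first block on the other, so its image would be both at least `n.len` and less than
`n.len`. -/
theorem len_le_of_sumHom_eq {k k' l l' n n' : DeltaA} {f : k ⟶ n} {f' : k' ⟶ n'}
    {g : l ⟶ n} {g' : l' ⟶ n'} (h : (⟨k.len + k'.len⟩ : DeltaA) = ⟨l.len + l'.len⟩)
    (e : sumHom f f' = eqToHom h ≫ sumHom g g') : l.len ≤ k.len := by
  by_contra hlt
  have hs : k.len + k'.len = l.len + l'.len := congrArg len h
  have hk : k.len < k.len + k'.len := by omega
  have := congrArg (fun t : (⟨k.len + k'.len⟩ : DeltaA) ⟶ ⟨n.len + n'.len⟩ =>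
    (t.map ⟨k.len, hk⟩).val) e
  simp only [comp_map, sumHom_val, eqToHom_map_val] at this
  rw [dif_neg (by omega), dif_pos (by omega)] at this
  omega

/-- The decomposition of a monotone map as an ordinal sum is unique. -/
theorem sumHom_injective {k k' l l' n n' : DeltaA} {f : k ⟶ n} {f' : k' ⟶ n'}
    {g : l ⟶ n} {g' : l' ⟶ n'} (h : (⟨k.len + k'.len⟩ : DeltaA) = ⟨l.len + l'.len⟩)
    (e : sumHom f f' = eqToHom h ≫ sumHom g g') :
    ∃ (h₁ : k = l) (h₂ : k' = l'), f = eqToHom h₁ ≫ g ∧ f' = eqToHom h₂ ≫ g' := by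
  have hs : k.len + k'.len = l.len + l'.len := congrArg len h
  have h₁ := len_le_of_sumHom_eq h e
  -- The same bound with the two decompositions exchanged.
  have h₂ : k.len ≤ l.len := len_le_of_sumHom_eq (f := g) (f' := g') (g := f) (g' := f') h.symm
    (by rw [e]; simp)
  obtain rfl : k = l := congrArg mk (le_antisymm h₂ h₁)
  obtain rfl : k' = l' := congrArg mk (Nat.add_left_cancel hs)
  rw [eqToHom_refl, Category.id_comp] at e
  refine ⟨rfl, rfl, ?_, ?_⟩
  · rw [eqToHom_refl, Category.id_comp]
    refine hom_ext fun i => ?_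
    have := congrArg (fun t : (⟨k.len + k'.len⟩ : DeltaA) ⟶ ⟨n.len + n'.len⟩ =>
      (t.map (Fin.castAdd k'.len i)).val) e
    simpa using this
  · rw [eqToHom_refl, Category.id_comp]
    refine hom_ext fun i => ?_
    have := congrArg (fun t : (⟨k.len + k'.len⟩ : DeltaA) ⟶ ⟨n.len + n'.len⟩ =>
      (t.map (Fin.natAdd k.len i)).val) e
    simpa using this

/-- Adding `0` on the right leaves the length unchanged by definition, so no `eqToHom` is needed, in
contrast with `sumHom_assoc`. -/
theorem sumHom_zero {m n : DeltaA} (f : m ⟶ n) (g : (⟨0⟩ : DeltaA) ⟶ ⟨0⟩) : sumHom f g = f :=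
  hom_ext fun i => by
    rw [sumHom_val]
    exact dif_pos (c := i.val < m.len) i.2

theorem sumHom_assoc {m n m' n' m'' n'' : DeltaA} (f : m ⟶ n) (f' : m' ⟶ n') (f'' : m'' ⟶ n'') :
    sumHom (sumHom f f') f'' ≫ eqToHom (congrArg mk (Nat.add_assoc _ _ _)) =
      eqToHom (congrArg mk (Nat.add_assoc _ _ _)) ≫ sumHom f (sumHom f' f'') :=
  hom_ext fun i => by
    simp only [comp_map, eqToHom_map_val, sumHom_val]
    grind

end DeltaA

/-! ### The strong monoidal functor that corresponds to a monoid object -/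

namespace TensorPower

open scoped MonObj

variable {M : Type u₁} [Category.{v₁} M] [MonoidalCategory M] (T : M)

/-- The tensor power `T^n`, bracketed to the left. -/
def power : ℕ → M
  | 0 => 𝟙_ M
  | n + 1 => power n ⊗ T

/-- Lets inductions on an exponent treat the casts between tensor powers as whiskered morphisms. -/
theorem eqToHom_power_succ {m n : ℕ} (h : m = n) :
    eqToHom (congrArg (fun k => power T (k + 1)) h) = eqToHom (congrArg (power T) h) ▷ T := by
  subst h
  exact (id_whiskerRight _ _).symm

/-- The isomorphism `T^m ⊗ T^n ≅ T^(m+n)`. -/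
def powerAdd (m : ℕ) : ∀ n : ℕ, power T m ⊗ power T n ≅ power T (m + n)
  | 0 => ρ_ (power T m)
  | n + 1 => (α_ (power T m) (power T n) T).symm ≪≫ whiskerRightIso (powerAdd m n) T

/-- Induction on `c`, the exponent on which `powerAdd` recurses: the step whiskers the hypothesis
with `T` and uses coherence of the associators. The cast appears because `a + b + c` and `a + (b +
c)` are not equal by definition. -/
theorem powerAdd_assoc (a b c : ℕ) :
    (powerAdd T a b).hom ▷ power T c ≫ (powerAdd T (a + b) c).hom ≫
        eqToHom (congrArg (power T) (Nat.add_assoc a b c)) =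
      (α_ _ _ _).hom ≫ power T a ◁ (powerAdd T b c).hom ≫ (powerAdd T a (b + c)).hom := by
  induction c with
  | zero =>
    -- Here and below, `key` replaces the tensor powers by arbitrary objects, so that rewriting does
    -- not depend on unfolding `power`; the definitional equalities are used only when `key` is
    -- applied.
    have key {A B D : M} (p : A ⊗ B ⟶ D) :
        p ▷ 𝟙_ M ≫ (ρ_ D).hom ≫ 𝟙 D = (α_ A B (𝟙_ M)).hom ≫ A ◁ (ρ_ B).hom ≫ p := by simp
    exact key _
  | succ c ih =>
    have key {A B C D E F G : M} {p : A ⊗ B ⟶ D} {q : D ⊗ C ⟶ E} {e : E ⟶ F} {r : B ⊗ C ⟶ G}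
        {s : A ⊗ G ⟶ F} (h : p ▷ C ≫ q ≫ e = (α_ A B C).hom ≫ A ◁ r ≫ s) :
        p ▷ (C ⊗ T) ≫ ((α_ _ _ _).inv ≫ q ▷ T) ≫ e ▷ T =
          (α_ A B (C ⊗ T)).hom ≫ A ◁ ((α_ _ _ _).inv ≫ r ▷ T) ≫ (α_ _ _ _).inv ≫ s ▷ T := by
      have h' := congrArg (fun t => t ▷ T) h
      simp only [comp_whiskerRight] at h'
      simp only [Category.assoc]
      rw [associator_inv_naturality_left_assoc, h']
      simp
    exact (congrArg (fun t => (powerAdd T a b).hom ▷ power T (c + 1) ≫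
      (powerAdd T (a + b) (c + 1)).hom ≫ t) (eqToHom_power_succ T (Nat.add_assoc a b c))).trans
      (key ih)

theorem powerAdd_zero_left (n : ℕ) :
    (powerAdd T 0 n).hom ≫ eqToHom (congrArg (power T) (Nat.zero_add n)) =
      (λ_ (power T n)).hom := by
  induction n with
  | zero => exact (Category.comp_id _).trans unitors_equal.symm
  | succ n ih =>
    have key {A B : M} {p : 𝟙_ M ⊗ A ⟶ B} {e : B ⟶ A} (h : p ≫ e = (λ_ A).hom) :
        ((α_ (𝟙_ M) A T).inv ≫ p ▷ T) ≫ e ▷ T = (λ_ (A ⊗ T)).hom := by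
      rw [Category.assoc, ← comp_whiskerRight, h]
      simp
    exact (congrArg (fun t => (powerAdd T 0 (n + 1)).hom ≫ t)
      (eqToHom_power_succ T (Nat.zero_add n))).trans (key ih)

/-! ### Iterated multiplication and the action of monotone maps on tensor powers -/

variable [MonObj T]

/-- The `n`-fold multiplication `T^n ⟶ T`. -/
def mulPower : ∀ n : ℕ, power T n ⟶ T
  | 0 => η[T]
  | n + 1 => mulPower n ▷ T ≫ μ[T]

/-- The first power is `𝟙_ M ⊗ T` rather than `T`, so the one-fold multiplication is a unitor and
not an identity. -/
theorem mulPower_one : mulPower T 1 = (λ_ T).hom := MonObj.one_mul T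

/-- General associativity. In the induction on `n` the base case is the right unit law of `T` and
the step is its associativity law. -/
theorem powerAdd_mulPower (m n : ℕ) :
    (powerAdd T m n).hom ≫ mulPower T (m + n) = (mulPower T m ⊗ₘ mulPower T n) ≫ μ[T] := by
  induction n with
  | zero =>
    have key {A : M} (p : A ⟶ T) : (ρ_ A).hom ≫ p = (p ⊗ₘ η[T]) ≫ μ[T] := by
      simp [MonoidalCategory.tensorHom_def]
    exact key _
  | succ n ih =>
    have key {A B D : M} {a : A ⊗ B ⟶ D} {d : D ⟶ T} {p : A ⟶ T} {q : B ⟶ T}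
        (h : a ≫ d = (p ⊗ₘ q) ≫ μ[T]) :
        ((α_ A B T).inv ≫ a ▷ T) ≫ d ▷ T ≫ μ[T] = (p ⊗ₘ (q ▷ T ≫ μ[T])) ≫ μ[T] := by
      rw [Category.assoc, ← comp_whiskerRight_assoc, h]
      simp [MonoidalCategory.tensorHom_def]
    exact key ih

/-- The morphism `T^m ⟶ T^n` induced by a monotone map. -/
noncomputable def powerMap : ∀ (n : ℕ) {m : DeltaA} (_ : m ⟶ ⟨n⟩), power T m.len ⟶ power T n
  | 0, _, f => eqToHom (congrArg (fun k : DeltaA => power T k.len) (DeltaA.eq_of_hom_zero f))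
  | n + 1, m, f =>
    -- The last point of the codomain is split off: recursion handles the part over `n`, and the
    -- block over the last point is multiplied out. The decomposition is an arbitrary choice;
    -- `sumHom_injective` makes it harmless.
    have h := DeltaA.exists_eq_sumHom (m := m) (n := ⟨n⟩) (n' := DeltaA.one) f
    eqToHom (congrArg (fun k : DeltaA => power T k.len)
        h.choose_spec.choose_spec.choose_spec.choose_spec.choose) ≫
      (powerAdd T h.choose.len h.choose_spec.choose.len).inv ≫
      (powerMap n h.choose_spec.choose_spec.choose ⊗ₘ mulPower T h.choose_spec.choose.len)

theorem powerMap_zero (f : (⟨0⟩ : DeltaA) ⟶ ⟨0⟩) : powerMap T 0 f = 𝟙 _ := rfl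

/-- By uniqueness of decompositions the chosen one must be `f`, `g`. This is the recursion equation
of `powerMap`, and the successor case is used below only through it. -/
theorem powerAdd_powerMap_sumHom_one {n : ℕ} {m m' : DeltaA} (f : m ⟶ ⟨n⟩)
    (g : m' ⟶ DeltaA.one) :
    (powerAdd T m.len m'.len).hom ≫ powerMap T (n + 1) (DeltaA.sumHom f g) =
      powerMap T n f ⊗ₘ mulPower T m'.len := by
  have h := DeltaA.exists_eq_sumHom (n := ⟨n⟩) (n' := DeltaA.one) (DeltaA.sumHom f g)
  have key : ∀ {k k' l : DeltaA} (a : k ⟶ ⟨n⟩) (b : k' ⟶ DeltaA.one)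
      (h : l = ⟨k.len + k'.len⟩) (h' : l = ⟨m.len + m'.len⟩)
      (_ : eqToHom h' ≫ DeltaA.sumHom f g = eqToHom h ≫ DeltaA.sumHom a b),
      eqToHom (congrArg (fun k : DeltaA => power T k.len) h) ≫
        (powerAdd T k.len k'.len).inv ≫ (powerMap T n a ⊗ₘ mulPower T k'.len) =
      eqToHom (congrArg (fun k : DeltaA => power T k.len) h') ≫
        (powerAdd T m.len m'.len).inv ≫ (powerMap T n f ⊗ₘ mulPower T m'.len) := by
    intro k k' l a b h h' e
    subst h'
    rw [eqToHom_refl, Category.id_comp] at e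
    obtain ⟨rfl, rfl, rfl, -⟩ := DeltaA.sumHom_injective _ e
    simp
  have := key h.choose_spec.choose_spec.choose
    h.choose_spec.choose_spec.choose_spec.choose
    h.choose_spec.choose_spec.choose_spec.choose_spec.choose rfl
    (by
      rw [eqToHom_refl, Category.id_comp]
      exact h.choose_spec.choose_spec.choose_spec.choose_spec.choose_spec)
  rw [eqToHom_refl, Category.id_comp] at this
  exact (Iso.eq_inv_comp _).1 this

theorem powerMap_eqToHom_comp {n : ℕ} {m m' : DeltaA} (h : m = m') (f : m' ⟶ ⟨n⟩) :
    powerMap T n (eqToHom h ≫ f) =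
      eqToHom (congrArg (fun k : DeltaA => power T k.len) h) ≫ powerMap T n f := by
  subst h; simp

theorem powerMap_id (n : ℕ) : powerMap T n (𝟙 (⟨n⟩ : DeltaA)) = 𝟙 (power T n) := by
  induction n with
  | zero => rfl
  | succ n ih =>
    have h := powerAdd_powerMap_sumHom_one T (𝟙 (⟨n⟩ : DeltaA)) (𝟙 DeltaA.one)
    rw [ih] at h
    have h' := (congrArg (fun t => (powerAdd T n 1).hom ≫ powerMap T (n + 1) t)
      (DeltaA.sumHom_id ⟨n⟩ DeltaA.one)).symm.trans h
    -- The identity of `n + 1` is the sum of those of `n` and `1`. Its last block contributes the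
    -- left unitor of `T`, which the triangle identity cancels against the right unitor inside
    -- `powerAdd T n 1`.
    have key {A : M} {t : A ⊗ T ⟶ A ⊗ T} {p : 𝟙_ M ⊗ T ⟶ T} (hp : p = (λ_ T).hom)
        (h : ((α_ A (𝟙_ M) T).inv ≫ (ρ_ A).hom ▷ T) ≫ t = 𝟙 A ⊗ₘ p) : t = 𝟙 _ := by
      rw [hp, triangle_assoc_comp_right] at h
      rw [← cancel_epi (A ◁ (λ_ T).hom), h]
      simp
    exact key (mulPower_one T) h'

/-- Multiplying inside the blocks and then multiplying the results is the same as multiplying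
everything at once. Induction on the number of blocks, with `powerAdd_mulPower` for the last one. -/
theorem powerMap_mulPower {n : ℕ} {m : DeltaA} (f : m ⟶ ⟨n⟩) :
    powerMap T n f ≫ mulPower T n = mulPower T m.len := by
  induction n generalizing m with
  | zero =>
    obtain rfl := DeltaA.eq_of_hom_zero f
    exact Category.id_comp _
  | succ n ih =>
    obtain ⟨k, k', g, g', rfl, rfl⟩ :=
      DeltaA.exists_eq_sumHom (n := ⟨n⟩) (n' := DeltaA.one) f
    rw [eqToHom_refl, Category.id_comp]
    have key {A B D E : M} {a : A ⊗ B ≅ D} {t : D ⟶ E ⊗ T} {d : D ⟶ T} {p : A ⟶ E} {q : B ⟶ T}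
        {r : E ⟶ T} (h : a.hom ≫ t = p ⊗ₘ q) (h' : a.hom ≫ d = ((p ≫ r) ⊗ₘ q) ≫ μ[T]) :
        t ≫ r ▷ T ≫ μ[T] = d := by
      rw [← cancel_epi a.hom, reassoc_of% h, h']
      simp [tensorHom_def']
    refine key (powerAdd_powerMap_sumHom_one T g g') ?_
    rw [ih g]
    exact powerAdd_mulPower T _ _

/-- Naturality of `powerAdd`. With the last block `b` of `g = a + b` split off, `f + (a + b)` is `(f
+ a) + b` up to a cast: the recursion equation removes `b`, induction handles `f + a`, and
`powerAdd_assoc` reconciles the bracketings. -/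
theorem powerAdd_powerMap_sumHom {n n' : ℕ} {m m' : DeltaA} (f : m ⟶ ⟨n⟩) (g : m' ⟶ ⟨n'⟩) :
    (powerAdd T m.len m'.len).hom ≫ powerMap T (n + n') (DeltaA.sumHom f g) =
      (powerMap T n f ⊗ₘ powerMap T n' g) ≫ (powerAdd T n n').hom := by
  induction n' generalizing m' with
  | zero =>
    obtain rfl := DeltaA.eq_of_hom_zero g
    have h : powerMap T (n + 0) (DeltaA.sumHom f g) = powerMap T n f :=
      congrArg (powerMap T n) (DeltaA.sumHom_zero f g)
    rw [h, powerMap_zero]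
    have key {A B : M} (p : A ⟶ B) : (ρ_ A).hom ≫ p = (p ⊗ₘ 𝟙 (𝟙_ M)) ≫ (ρ_ B).hom := by simp
    exact key _
  | succ n' ih =>
    obtain ⟨k, k', a, b, rfl, rfl⟩ :=
      DeltaA.exists_eq_sumHom (n := ⟨n'⟩) (n' := DeltaA.one) g
    rw [eqToHom_refl, Category.id_comp]
    have e : DeltaA.sumHom (DeltaA.sumHom f a) b =
        eqToHom (congrArg DeltaA.mk (Nat.add_assoc _ _ _)) ≫
          DeltaA.sumHom f (DeltaA.sumHom a b) :=
      (Category.comp_id _).symm.trans (DeltaA.sumHom_assoc f a b)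
    have h₁ := powerAdd_powerMap_sumHom_one (n := n + n') T (DeltaA.sumHom f a) b
    have h₂ := powerMap_eqToHom_comp T (congrArg DeltaA.mk (Nat.add_assoc m.len k.len k'.len))
      (n := n + (n' + 1)) (DeltaA.sumHom (n := ⟨n⟩) (n' := ⟨n' + 1⟩) f (DeltaA.sumHom a b))
    have h₃ := powerAdd_powerMap_sumHom_one T a b
    have h₄ := powerAdd_assoc T m.len k.len k'.len
    have key {A B C AB BC ABC ABC' N N' NN : M} {p : A ⊗ B ≅ AB} {q : AB ⊗ C ≅ ABC}
        {c : ABC ⟶ ABC'} {r : B ⊗ C ≅ BC} {s : A ⊗ BC ⟶ ABC'} {t : ABC ⟶ NN ⊗ T}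
        {t' : ABC' ⟶ NN ⊗ T} {x : AB ⟶ NN} {y : C ⟶ T} {z : BC ⟶ N' ⊗ T} {w : B ⟶ N'}
        {v : A ⟶ N} {o : N ⊗ N' ⟶ NN}
        (h₁ : q.hom ≫ t = x ⊗ₘ y) (h₂ : t = c ≫ t') (h₃ : r.hom ≫ z = w ⊗ₘ y)
        (h₄ : p.hom ▷ C ≫ q.hom ≫ c = (α_ A B C).hom ≫ A ◁ r.hom ≫ s)
        (ih : p.hom ≫ x = (v ⊗ₘ w) ≫ o) :
        s ≫ t' = (v ⊗ₘ z) ≫ (α_ N N' T).inv ≫ o ▷ T := by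
      subst h₂
      rw [← cancel_epi (A ◁ r.hom), ← cancel_epi (α_ A B C).hom]
      have h₄' := congrArg (fun k => k ≫ t') h₄
      simp only [Category.assoc] at h₄'
      rw [← h₄', h₁, tensorHom_def', ← whisker_exchange_assoc, ← comp_whiskerRight, ih]
      have : A ◁ r.hom ≫ (v ⊗ₘ z) = v ⊗ₘ (w ⊗ₘ y) := by
        rw [← h₃]; simp [tensorHom_def']
      rw [reassoc_of% this]
      simp [tensorHom_def']
    exact key h₁ ((congrArg (powerMap T (n + n' + 1)) e).trans h₂) h₃ h₄ (ih a)

/-- Split `g = a + b` over the last point of its codomain, then split `f = c + d` over the resulting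
sum, so that the composite is `(c ≫ a) + (d ≫ b)`. Induction gives the first summand and
`powerMap_mulPower` the second. -/
theorem powerMap_comp {n p : ℕ} {m : DeltaA} (f : m ⟶ ⟨n⟩) (g : (⟨n⟩ : DeltaA) ⟶ ⟨p⟩) :
    powerMap T p (f ≫ g) = powerMap T n f ≫ powerMap T p g := by
  induction p generalizing n m with
  | zero =>
    have h := DeltaA.eq_of_hom_zero g
    obtain rfl : n = 0 := congrArg DeltaA.len h
    obtain rfl := DeltaA.eq_of_hom_zero f
    exact (Category.id_comp _).symm
  | succ p ih =>
    obtain ⟨k, k', a, b, h, e⟩ :=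
      DeltaA.exists_eq_sumHom (n := ⟨p⟩) (n' := DeltaA.one) g
    obtain rfl : n = k.len + k'.len := congrArg DeltaA.len h
    rw [eqToHom_refl, Category.id_comp] at e
    subst e
    obtain ⟨l, l', c, d, rfl, rfl⟩ := DeltaA.exists_eq_sumHom f
    rw [eqToHom_refl, Category.id_comp, ← cancel_epi (powerAdd T l.len l'.len).hom]
    have h₁ := powerAdd_powerMap_sumHom_one T (c ≫ a) (d ≫ b)
    have h₂ := powerAdd_powerMap_sumHom T c d
    have h₃ := powerAdd_powerMap_sumHom_one T a b
    have h₄ := powerMap_mulPower T d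
    rw [ih] at h₁
    refine Eq.trans (congrArg (fun t => (powerAdd T l.len l'.len).hom ≫ powerMap T (p + 1) t)
      (DeltaA.sumHom_comp c a d b).symm) (h₁.trans ?_)
    rw [reassoc_of% h₂]
    refine Eq.trans ?_ (congrArg (fun t => (powerMap T k.len c ⊗ₘ powerMap T k'.len d) ≫ t)
      h₃).symm
    rw [← h₄]
    exact (tensorHom_comp_tensorHom _ _ _ _).symm

/-! ### The functor of tensor powers, its strong monoidal structure and its image of `1` -/

/-- The functor `n ↦ T^n` on the augmented simplex category, for a monoid object `T`. -/
noncomputable def functor : DeltaA ⥤ M where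
  obj n := power T n.len
  map {_ n} f := powerMap T n.len f
  map_id n := powerMap_id T n.len
  map_comp f g := powerMap_comp T f g

/-- The associator and unitors of `Δ_a` are such casts; this turns their images into the `eqToHom`
of `powerAdd_assoc` and `powerAdd_zero_left`. -/
theorem functor_map_castIso {m n : DeltaA} (h : m = n) :
    (functor T).map (DeltaA.castIso (congrArg DeltaA.len h)).hom =
      eqToHom (congrArg (fun k : DeltaA => power T k.len) h) := by
  rw [DeltaA.castIso_hom_eq_eqToHom h, eqToHom_map]
  rfl

/-- The functor `n ↦ T^n` is strong monoidal. -/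
noncomputable def functorCoreMonoidal : (functor T).CoreMonoidal where
  εIso := Iso.refl _
  μIso m n := powerAdd T m.len n.len
  μIso_hom_natural_left {m n} f k := by
    have h := powerAdd_powerMap_sumHom T f (𝟙 k)
    rw [powerMap_id, tensorHom_id] at h
    exact h.symm
  μIso_hom_natural_right {m n} k f := by
    have h := powerAdd_powerMap_sumHom T (𝟙 k) f
    rw [powerMap_id, id_tensorHom] at h
    exact h.symm
  associativity k m n := by
    refine Eq.trans ?_ (powerAdd_assoc T k.len m.len n.len)
    exact congrArg (fun t => (powerAdd T k.len m.len).hom ▷ power T n.len ≫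
      (powerAdd T (k.len + m.len) n.len).hom ≫ t) (functor_map_castIso T
        (congrArg DeltaA.mk (Nat.add_assoc k.len m.len n.len)))
  left_unitality n := by
    refine (powerAdd_zero_left T n.len).symm.trans ?_
    have h := functor_map_castIso T (congrArg DeltaA.mk (Nat.zero_add n.len))
    have key {A B : M} (p : 𝟙_ M ⊗ A ⟶ B) : p = 𝟙 (𝟙_ M) ▷ A ≫ p := by simp
    refine (key _).trans ?_
    exact congrArg (fun t => 𝟙 (𝟙_ M) ▷ power T n.len ≫ (powerAdd T 0 n.len).hom ≫ t) h.symm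
  right_unitality n := by
    have h := functor_map_castIso T (congrArg DeltaA.mk (Nat.add_zero n.len))
    have key {A : M} {t : A ⟶ A} (h : t = 𝟙 A) :
      (ρ_ A).hom = A ◁ 𝟙 (𝟙_ M) ≫ (ρ_ A).hom ≫ t := by simp [h]
    exact key h

noncomputable instance : (functor T).Monoidal := (functorCoreMonoidal T).toMonoidal

/-- The unitor is the one-fold multiplication, so this is `powerMap_mulPower` over a single block.
It shows that the unitor from `F(1) = 𝟙_ M ⊗ T` to `T` respects units and multiplications. -/
theorem powerMap_to_one {m : DeltaA} (f : m ⟶ DeltaA.one) :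
    powerMap T 1 f ≫ (λ_ T).hom = mulPower T m.len := by
  have h := powerMap_mulPower T (n := 1) f
  rwa [mulPower_one] at h

/-- The functor `n ↦ T^n` corresponds to the monoid object `T`. -/
noncomputable def toMonFunctorIso (T : Mon M) : DeltaA.toMon (functor T.X) ≅ T :=
  Mon.mkIso (M := DeltaA.toMon (functor T.X)) (N := T) (λ_ T.X)
    (by
      have h := powerMap_to_one T.X (η[DeltaA.one])
      have key {A : M} {B : M} {t : 𝟙_ M ⟶ A} {l : A ⟶ B} {e : 𝟙_ M ⟶ B} (h : t ≫ l = e) :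
        (𝟙 _ ≫ t) ≫ l = e := by simp [h]
      exact key h)
    (by
      have h := powerMap_to_one T.X (μ[DeltaA.one])
      have h' := powerAdd_mulPower T.X 1 1
      rw [mulPower_one] at h'
      refine Eq.trans ?_ h'
      exact (Category.assoc _ _ _).trans (congrArg (fun t => (powerAdd T.X 1 1).hom ≫ t) h))

end TensorPower

/-! ### Squares of profunctors -/

theorem DoubleStruct.SqEq.subst {D : DoubleStruct.{u₁, v₁, w₁, x₁}} {A B A' B' : D.Obj}
    {X : D.Hor A B} {Y : D.Hor A' B'} {P : ∀ (f : A ⟶ A') (g : B ⟶ B'), D.Sq X Y f g → Prop}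
    {f f' : A ⟶ A'} {g g' : B ⟶ B'} {α : D.Sq X Y f g} {β : D.Sq X Y f' g'}
    (h : D.SqEq α β) (hα : P f g α) : P f' g' β := by
  cases h; exact hα

namespace ProfOp

/-- The equality is heterogeneous because the sides of the two squares may be different functors, so
that the values lie in different sets. -/
theorem sqEq_app_heq {A B A' B' : Cat.{u, u}} {H : Profunctor.{u} B A} {H' : Profunctor.{u} B' A'}
    {F F' : A ⟶ A'} {G G' : B ⟶ B'} {α : Square H H' F.toFunctor G.toFunctor}
    {β : Square H H' F'.toFunctor G'.toFunctor}
    (h : @DoubleStruct.SqEq PROFop.{u}.toDoubleStruct A B A' B' H H' F F' G G' α β)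
    {a : A} {b : B} (x : el H a b) : HEq (α.app x) (β.app x) := by
  exact DoubleStruct.SqEq.subst (D := struct.{u}) (X := H) (Y := H')
    (P := fun F₁ G₁ (γ : Square H H' (Cat.Hom.toFunctor F₁) (Cat.Hom.toFunctor G₁)) =>
      HEq (α.app x) (γ.app x)) h HEq.rfl

theorem sqEq_app {A B A' B' : Cat.{u, u}} {H : Profunctor.{u} B A} {H' : Profunctor.{u} B' A'}
    {F : A ⟶ A'} {G : B ⟶ B'} {α β : Square H H' F.toFunctor G.toFunctor}
    (h : @DoubleStruct.SqEq PROFop.{u}.toDoubleStruct A B A' B' H H' F F G G α β)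
    {a : A} {b : B} (x : el H a b) : α.app x = β.app x :=
  eq_of_heq (sqEq_app_heq h x)

end ProfOp

open ProfOp

section

variable {M : Type u₁} [Category.{v₁} M]

/-! ### The morphisms from `F(n)` to `T` induced by terminality of `1` -/

namespace DeltaA

/-- The morphism `F(n) ⟶ X` obtained from a morphism `F(1) ⟶ X` and the map from `n` to the
terminal object `1`. -/
def fromOne (F : DeltaA ⥤ M) {X : M} (s : F.obj one ⟶ X) (n : DeltaA) : F.obj n ⟶ X :=
  F.map default ≫ s

variable {F : DeltaA ⥤ M}

theorem fromOne_one {X : M} (s : F.obj one ⟶ X) : fromOne F s one = s := by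
  have : (default : one ⟶ one) = 𝟙 one := Subsingleton.elim _ _
  rw [fromOne, this, F.map_id, Category.id_comp]

theorem map_fromOne {X : M} (s : F.obj one ⟶ X) {m n : DeltaA} (t : m ⟶ n) :
    F.map t ≫ fromOne F s n = fromOne F s m := by
  rw [fromOne, ← F.map_comp_assoc, Subsingleton.elim (t ≫ default) default]
  rfl

end DeltaA

variable [MonoidalCategory M] {T : Mon M} {C : Type u} [Category.{u} C] {Φ : Metamodel M C}
  {F : DeltaA ⥤ M} [F.Monoidal]

open scoped MonObj

namespace DeltaA

/-- The morphism `F(1) ⟶ T` underlying an isomorphism of monoids. -/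
def isoHom (e : toMon F ≅ T) : F.obj one ⟶ T.X := e.hom.hom

/-- The morphism `T ⟶ F(1)` underlying an isomorphism of monoids. -/
def isoInv (e : toMon F ≅ T) : T.X ⟶ F.obj one := e.inv.hom

variable (e : toMon F ≅ T)

theorem isoHom_isoInv : isoHom e ≫ isoInv e = 𝟙 (F.obj one) :=
  congrArg Mon.Hom.hom e.hom_inv_id

theorem isoInv_isoHom : isoInv e ≫ isoHom e = 𝟙 T.X :=
  congrArg Mon.Hom.hom e.inv_hom_id

/-- The unit of `toMon F` is `ε` followed by the image of `η[one]`, and its multiplication is `μ`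
followed by the image of `μ[one]`; here and in the next lemmas the monoid homomorphism laws are
written out accordingly. -/
theorem one_isoHom : Functor.LaxMonoidal.ε F ≫ F.map η[one] ≫ isoHom e = η[T.X] :=
  (Category.assoc _ _ _).symm.trans (IsMonHom.one_hom e.hom.hom)

theorem mul_isoHom : Functor.LaxMonoidal.μ F one one ≫ F.map μ[one] ≫ isoHom e =
    (isoHom e ⊗ₘ isoHom e) ≫ μ[T.X] :=
  (Category.assoc _ _ _).symm.trans (IsMonHom.mul_hom e.hom.hom)

theorem one_isoInv : η[T.X] ≫ isoInv e = Functor.LaxMonoidal.ε F ≫ F.map η[one] := by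
  rw [← one_isoHom e, Category.assoc, Category.assoc, isoHom_isoInv, Category.comp_id]

theorem mul_isoInv : μ[T.X] ≫ isoInv e =
    (isoInv e ⊗ₘ isoInv e) ≫ Functor.LaxMonoidal.μ F one one ≫ F.map μ[one] := by
  have h := congrArg (fun t => (isoInv e ⊗ₘ isoInv e) ≫ t ≫ isoInv e) (mul_isoHom e)
  simp only [Category.assoc, isoHom_isoInv, tensorHom_comp_tensorHom_assoc, isoInv_isoHom,
    id_tensorHom_id, Category.id_comp, Category.comp_id] at h
  exact h.symm

/-- By terminality the map `0 ⟶ 1` is the unit of the monoid `1`. This is what turns the unit axiom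
of a model into the unit condition of the cone. -/
theorem fromOne_unit :
    fromOne F (isoHom e) (𝟙_ DeltaA) = Functor.OplaxMonoidal.η F ≫ η[T.X] := by
  rw [← one_isoHom e, fromOne, Subsingleton.elim (default : 𝟙_ DeltaA ⟶ one) η[one]]
  simp

/-- By terminality `m + n ⟶ 1` is the sum of `m ⟶ 1` and `n ⟶ 1` followed by the multiplication of
`1`. This turns the multiplication axiom of a model into the composition condition of the cone. -/
theorem fromOne_tensor (m n : DeltaA) :
    fromOne F (isoHom e) (m ⊗ n) = Functor.OplaxMonoidal.δ F m n ≫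
      (fromOne F (isoHom e) m ⊗ₘ fromOne F (isoHom e) n) ≫ μ[T.X] := by
  have h : (default : m ⊗ n ⟶ one) =
      ((default : m ⟶ one) ⊗ₘ (default : n ⟶ one)) ≫ μ[one] := Subsingleton.elim _ _
  rw [fromOne, fromOne, fromOne, ← tensorHom_comp_tensorHom, Category.assoc, ← mul_isoHom, h,
    F.map_comp]
  simp [Functor.LaxMonoidal.μ_natural_assoc]

end DeltaA

/-! ### The universal cone -/

variable (e : DeltaA.toMon F ≅ T)

/-- The universal vertical double cone over `Φ(F)`, with vertex the category of models. -/
def Model.cone : VerticalDoubleCone (Φ.diagram F) (Cat.of (Model T Φ)) where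
  leg _ := (Model.forget T Φ).toCatHom
  leg_naturality _ := rfl
  cell X := Model.squareComp T Φ (DeltaA.fromOne F (DeltaA.isoHom e) (unop X))
  cell_naturality {_ _ _ _ X Y _ _} α :=
    struct_sqEq (A := Cat.of (Model T Φ)) (B := Cat.of (Model T Φ)) (A' := Cat.of C)
      (B' := Cat.of C) (fun p q f => by
        refine (Φ.natApp_map_comp _ _ _).symm.trans ?_
        have h := DeltaA.map_fromOne (DeltaA.isoHom e) (Quiver.Hom.unop α)
        exact congrArg (fun s : _ ⟶ _ => natApp (Φ.functor.map s.op) _) h)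
  cell_hid i :=
    struct_sqEq (A := Cat.of (Model T Φ)) (B := Cat.of (Model T Φ)) (A' := Cat.of C)
      (B' := Cat.of C) (fun p q f => by
        change natApp (Φ.functor.map (DeltaA.fromOne F (DeltaA.isoHom e) (𝟙_ DeltaA)).op)
            (act _ (𝟙 _) (toHom f).hom p.str) =
          natApp (Φ.functor.map (Functor.OplaxMonoidal.η F).op)
            (act _ (𝟙 _) (toHom f).hom (Φ.unit p.carrier))
        rw [DeltaA.fromOne_unit, op_comp, Φ.natApp_map_comp, natApp_act, p.str_one])
  cell_hcomp X Y :=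
    struct_sqEq (A := Cat.of (Model T Φ)) (B := Cat.of (Model T Φ)) (A' := Cat.of C)
      (B' := Cat.of C) (fun p q f => by
        -- The inverse left unit square sends `f` to the class of the identity followed by `f`, so
        -- the factor at `X` is evaluated at an identity.
        change natApp (Φ.functor.map
              (DeltaA.fromOne F (DeltaA.isoHom e) (Opposite.unop Y ⊗ Opposite.unop X)).op)
            (act _ (𝟙 _) (toHom f).hom p.str) =
          natApp (Φ.functor.map (Functor.OplaxMonoidal.δ F (Opposite.unop Y) (Opposite.unop X)).op)
            (Φ.mul (natApp (Φ.functor.map (DeltaA.fromOne F (DeltaA.isoHom e) (unop Y)).op)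
              (act _ (𝟙 _) (toHom f).hom p.str))
              (natApp (Φ.functor.map (DeltaA.fromOne F (DeltaA.isoHom e) (unop X)).op)
              (act _ (𝟙 _) (𝟙 _) p.str)))
        rw [DeltaA.fromOne_tensor, op_comp, Φ.natApp_map_comp, op_comp, Φ.natApp_map_comp,
          natApp_act, p.str_mul, Φ.mul_naturality, Φ.mul_act])

/-! ### The universal property -/

section

variable {A : Cat.{u, u}} (x : VerticalDoubleCone (Φ.diagram F) A)

/-- The functor to `C` underlying a vertical double cone. -/
def VerticalDoubleCone.functor : A ⥤ C := Cat.Hom.toFunctor (x.leg ⟨⟨⟩⟩)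

/-- The square at `n` of a vertical double cone. -/
def VerticalDoubleCone.square (n : DeltaA) :
    Square (homProf A) (Φ.functor.obj (op (F.obj n))) x.functor x.functor :=
  x.cell (i := ⟨⟨⟩⟩) (j := ⟨⟨⟩⟩) (op n)

/-- For `n` the terminal object `1`, this recovers every square of the cone from the one at `1`. -/
theorem VerticalDoubleCone.natApp_square {m n : DeltaA} (t : m ⟶ n) {a b : A}
    (f : el (homProf A) a b) :
    natApp (Φ.functor.map (F.map t).op) ((x.square n).app f) = (x.square m).app f :=
  sqEq_app (A' := Cat.of C) (B' := Cat.of C) (F := x.leg ⟨⟨⟩⟩) (G := x.leg ⟨⟨⟩⟩)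
    (x.cell_naturality (i := ⟨⟨⟩⟩) (j := ⟨⟨⟩⟩) (i' := ⟨⟨⟩⟩) (j' := ⟨⟨⟩⟩) (X := op n) (Y := op m)
    (f := 𝟙 _) (g := 𝟙 _) t.op) f

theorem VerticalDoubleCone.square_unit (a : A) :
    (x.square (𝟙_ DeltaA)).app (ofHom (𝟙 a)) =
      natApp (Φ.functor.map (Functor.OplaxMonoidal.η F).op) (Φ.unit (x.functor.obj a)) := by
  have h : (x.square (𝟙_ DeltaA)).app (ofHom (𝟙 a)) =
      natApp (Φ.functor.map (Functor.OplaxMonoidal.η F).op)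
        (act _ (𝟙 _) (x.functor.map (𝟙 a)) (Φ.unit (x.functor.obj a))) :=
    sqEq_app (A' := Cat.of C) (B' := Cat.of C) (F := x.leg ⟨⟨⟩⟩) (G := x.leg ⟨⟨⟩⟩)
      (x.cell_hid ⟨⟨⟩⟩) (ofHom (𝟙 a))
  rw [h, x.functor.map_id, act_id]

theorem VerticalDoubleCone.square_tensor (m n : DeltaA) {a b : A} (f : el (homProf A) a b) :
    (x.square (n ⊗ m)).app f =
      natApp (Φ.functor.map (Functor.OplaxMonoidal.δ F n m).op)
        (Φ.mul ((x.square n).app f) ((x.square m).app (ofHom (𝟙 a)))) :=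
  sqEq_app (A' := Cat.of C) (B' := Cat.of C) (F := x.leg ⟨⟨⟩⟩) (G := x.leg ⟨⟨⟩⟩)
    (x.cell_hcomp (i := ⟨⟨⟩⟩) (j := ⟨⟨⟩⟩) (k := ⟨⟨⟩⟩) (op m) (op n)) f

/-- Yoneda: the square is determined by its values at identities. Together with `square_act` it
shows that those values satisfy the homomorphism equation for `x.functor.map f`. -/
theorem VerticalDoubleCone.act_square (n : DeltaA) {a b : A} (f : a ⟶ b) :
    act _ (𝟙 _) (x.functor.map f) ((x.square n).app (ofHom (𝟙 a))) =
      (x.square n).app (ofHom f) := by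
  have h := (x.square n).naturality (𝟙 a) f (ofHom (𝟙 a))
  rw [act_ofHom, x.functor.map_id] at h
  simpa using h.symm

theorem VerticalDoubleCone.square_act (n : DeltaA) {a b : A} (f : a ⟶ b) :
    act _ (x.functor.map f) (𝟙 _) ((x.square n).app (ofHom (𝟙 b))) =
      (x.square n).app (ofHom f) := by
  have h := (x.square n).naturality f (𝟙 b) (ofHom (𝟙 b))
  rw [act_ofHom, x.functor.map_id] at h
  simpa using h.symm

/-- The functor to the category of models induced by a vertical double cone. -/
def VerticalDoubleCone.toModel : A ⥤ Model T Φ where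
  obj a :=
    { carrier := x.functor.obj a
      str := natApp (Φ.functor.map (DeltaA.isoInv e).op)
        ((x.square DeltaA.one).app (ofHom (𝟙 a)))
      str_one := by
        -- Naturality along `η[one] : 0 ⟶ 1` moves to the square at `0`, which the unit condition
        -- computes; `ε` and `η` of `F` then cancel.
        rw [← Φ.natApp_map_comp, ← op_comp, DeltaA.one_isoInv, op_comp, Φ.natApp_map_comp,
          x.natApp_square, x.square_unit, ← Φ.natApp_map_comp, ← op_comp,
          Functor.Monoidal.ε_η, op_id, Φ.natApp_map_id]
      str_mul := by
        -- Likewise along `μ[one] : 1 + 1 ⟶ 1`, with the composition condition and the cancellation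
        -- of `μ` and `δ`.
        rw [← Φ.natApp_map_comp, ← op_comp, DeltaA.mul_isoInv, op_comp, op_comp,
          Φ.natApp_map_comp, Φ.natApp_map_comp,
          x.natApp_square, x.square_tensor, ← Φ.natApp_map_comp (Functor.OplaxMonoidal.δ F _ _).op,
          ← op_comp, Functor.Monoidal.μ_δ, op_id, Φ.natApp_map_id, Φ.mul_naturality] }
  map f := ⟨x.functor.map f, by
    rw [← natApp_act, ← natApp_act, x.act_square, x.square_act]⟩
  map_id a := Model.Hom.ext (x.functor.map_id a)
  map_comp f g := Model.Hom.ext (x.functor.map_comp f g)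

theorem VerticalDoubleCone.isFactorization_toModel :
    x.IsFactorization (Model.cone e) (x.toModel e).toCatHom where
  leg i := rfl
  cell {i j} X :=
    struct_sqEq (A := A) (B := A) (A' := Cat.of C) (B' := Cat.of C) (F := x.leg ⟨⟨⟩⟩)
      (G := x.leg ⟨⟨⟩⟩) (fun a b f => by
        change natApp (Φ.functor.map (DeltaA.fromOne F (DeltaA.isoHom e) (unop X)).op)
          (act _ (𝟙 _) (x.functor.map (toHom f)) (natApp (Φ.functor.map (DeltaA.isoInv e).op)
        ((x.square DeltaA.one).app (ofHom (𝟙 a))))) = (x.square (unop X)).app f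
        -- The composite of `F(n) ⟶ F(1)` with `F(1) ⟶ T ⟶ F(1)` is `F(n) ⟶ F(1)` again, so
        -- naturality of the cone gives its square at `n`.
        rw [DeltaA.fromOne, ← natApp_act, x.act_square, ← Φ.natApp_map_comp, ← op_comp,
          Category.assoc, DeltaA.isoHom_isoInv, Category.comp_id, x.natApp_square]
        rfl)

end

/-! ### Uniqueness of the factorization of a cone -/

theorem Model.ext_heq {p q : Model T Φ} (h : p.carrier = q.carrier) (h' : HEq p.str q.str) :
    p = q := by
  obtain ⟨c, s, _, _⟩ := p
  obtain ⟨c', s', _, _⟩ := q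
  obtain rfl : c = c' := h
  obtain rfl : s = s' := eq_of_heq h'
  rfl

/-- A functor to the category of models is determined by its underlying functor and by the
structures on its values. -/
theorem Model.functor_ext {A : Type u} [Category.{u} A] {c d : A ⥤ Model T Φ}
    (h : c ⋙ Model.forget T Φ = d ⋙ Model.forget T Φ)
    (h' : ∀ a, HEq (c.obj a).str (d.obj a).str) : c = d := by
  have hom_heq : ∀ {p p' q q' : Model T Φ} (hp : p = p') (hq : q = q') (f : p ⟶ q)
      (g : p' ⟶ q'), HEq f.hom g.hom → HEq f g := by
    rintro p _ q _ rfl rfl f g h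
    exact heq_of_eq (Model.Hom.ext (eq_of_heq h))
  have hobj : ∀ a, c.obj a = d.obj a := fun a =>
    Model.ext_heq (Functor.congr_obj h a) (h' a)
  refine Functor.hext hobj (fun a b f => hom_heq (hobj a) (hobj b) _ _ ?_)
  have := Functor.hcongr_hom h f
  exact this

/-- `Φ` is contravariant in `M`, so the section `r` of `s` gives a retraction of `Φ_s`. With `s` the
isomorphism from `F(1)` to `T`, equations over `F(1)` can be read over `T`. -/
theorem Metamodel.natApp_injective {X Y : M} {s : X ⟶ Y} {r : Y ⟶ X} (hr : r ≫ s = 𝟙 _) {a b : C}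
    {y z : el (Φ.functor.obj (op Y)) a b}
    (h : natApp (Φ.functor.map s.op) y = natApp (Φ.functor.map s.op) z) : y = z := by
  have := congrArg (natApp (Φ.functor.map r.op)) h
  simpa only [← Φ.natApp_map_comp, ← op_comp, hr, op_id, Φ.natApp_map_id] using this

theorem Metamodel.act_eq_act_of_natApp {X Y : M} {s : X ⟶ Y} {r : Y ⟶ X} (hr : r ≫ s = 𝟙 _)
    {a b : C} (f : a ⟶ b) (y : el (Φ.functor.obj (op Y)) a a) (z : el (Φ.functor.obj (op Y)) b b)
    (h : act _ (𝟙 a) f (natApp (Φ.functor.map s.op) y) =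
      act _ f (𝟙 b) (natApp (Φ.functor.map s.op) z)) :
    act _ (𝟙 a) f y = act _ f (𝟙 b) z := by
  rw [← natApp_act, ← natApp_act] at h
  exact Metamodel.natApp_injective hr h

theorem Model.str_heq_of_natApp {p q : Model T Φ} (h : p.carrier = q.carrier) {X : M}
    {s : X ⟶ T.X} {r : T.X ⟶ X} (hr : r ≫ s = 𝟙 _)
    (h' : HEq (natApp (Φ.functor.map s.op) p.str) (natApp (Φ.functor.map s.op) q.str)) :
    HEq p.str q.str := by
  obtain ⟨c, y, _, _⟩ := p
  obtain ⟨c', z, _, _⟩ := q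
  obtain rfl : c = c' := h
  exact heq_of_eq (Metamodel.natApp_injective hr (eq_of_heq h'))

/-- The square at `1` of the composite of the universal cone with a functor. -/
def Model.coneSquare {A : Cat.{u, u}} (c : A ⟶ Cat.of (Model T Φ)) :
    Square (homProf A) (Φ.functor.obj (op (F.obj DeltaA.one)))
      (c.toFunctor ⋙ Model.forget T Φ) (c.toFunctor ⋙ Model.forget T Φ) :=
  PROFop.{u}.sqComp (PROFop.{u}.hidSq c)
    ((Model.cone (Φ := Φ) e).cell (i := ⟨⟨⟩⟩) (j := ⟨⟨⟩⟩) (op DeltaA.one))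

/-- Evaluation at an identity extracts the structure of the model `c a`, transported to `F(1)`; this
is how the composite cone remembers `c`. -/
theorem Model.coneSquare_app_id {A : Cat.{u, u}} (c : A ⟶ Cat.of (Model T Φ)) (a : A) :
    (Model.coneSquare e c).app (ofHom (𝟙 a)) =
      natApp (Φ.functor.map (DeltaA.isoHom e).op) (c.toFunctor.obj a).str := by
  change natApp (Φ.functor.map (DeltaA.fromOne F (DeltaA.isoHom e) DeltaA.one).op)
    (act _ (𝟙 _) (c.toFunctor.map (𝟙 a)).hom (c.toFunctor.obj a).str) = _
  have h : (c.toFunctor.map (𝟙 a)).hom = 𝟙 (c.toFunctor.obj a).carrier :=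
    congrArg Model.Hom.hom (c.toFunctor.map_id a)
  rw [DeltaA.fromOne_one, h, act_id]

/-- The leg fixes the underlying functor, and the square at `1`, evaluated at identities, fixes the
structures. The carriers agree only propositionally, hence the heterogeneous equality. -/
theorem VerticalDoubleCone.isFactorization_unique {A : Cat.{u, u}}
    {x : VerticalDoubleCone (Φ.diagram F) A} {c d : A ⟶ Cat.of (Model T Φ)}
    (hc : x.IsFactorization (Model.cone e) c) (hd : x.IsFactorization (Model.cone e) d) :
    c = d := by
  have h : c.toFunctor ⋙ Model.forget T Φ = d.toFunctor ⋙ Model.forget T Φ :=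
    congrArg Cat.Hom.toFunctor ((hc.leg ⟨⟨⟩⟩).trans (hd.leg ⟨⟨⟩⟩).symm)
  refine Cat.Hom.ext (Model.functor_ext h fun a => ?_)
  refine Model.str_heq_of_natApp (Functor.congr_obj h a) (DeltaA.isoInv_isoHom e) ?_
  rw [← Model.coneSquare_app_id, ← Model.coneSquare_app_id]
  exact sqEq_app_heq (A' := Cat.of C) (B' := Cat.of C) ((hc.cell (i := ⟨⟨⟩⟩) (j := ⟨⟨⟩⟩)
    (op DeltaA.one)).trans (hd.cell (i := ⟨⟨⟩⟩) (j := ⟨⟨⟩⟩) (op DeltaA.one)).symm) (ofHom (𝟙 a))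

/-! ### Factorization of modifications -/

/-- A square to the hom-functor of `C` whose values are homomorphisms of models lifts uniquely to
the hom-functor of the category of models. -/
theorem Model.existsUnique_square {A B : Type u} [Category.{u} A] [Category.{u} B]
    {H : Profunctor.{u} B A} {c : A ⥤ Model T Φ} {d : B ⥤ Model T Φ}
    (θ : Square H (homProf C) (c ⋙ Model.forget T Φ) (d ⋙ Model.forget T Φ))
    (hθ : ∀ {a : A} {b : B} (h : el H a b),
      act _ (𝟙 _) (toHom (θ.app h)) (c.obj a).str = act _ (toHom (θ.app h)) (𝟙 _) (d.obj b).str) :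
    ∃! σ : Square H (homProf (Model T Φ)) c d,
      ∀ {a : A} {b : B} (h : el H a b), (toHom (σ.app h)).hom = toHom (θ.app h) := by
  refine ⟨⟨fun h => ofHom (⟨toHom (θ.app h), hθ h⟩ : Model.Hom _ _), fun f g h => ?_⟩,
    fun h => rfl, fun τ hτ => ?_⟩
  · rw [act_ofHom]
    refine Model.Hom.ext ?_
    have := congrArg toHom (θ.naturality f g h)
    rw [toHom_act] at this
    exact this
  · refine Square.ext ?_
    funext a b h
    exact Model.Hom.ext (hτ h)

theorem Model.existsUnique_sq {A B : Cat.{u, u}} {x : VerticalDoubleCone (Φ.diagram F) A}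
    {y : VerticalDoubleCone (Φ.diagram F) B} {H : Profunctor.{u} B A}
    (ξ : ConeModification x y H) {c : A ⟶ Cat.of (Model T Φ)} {d : B ⟶ Cat.of (Model T Φ)}
    (hx : x.IsFactorization (Model.cone e) c) (hy : y.IsFactorization (Model.cone e) d) :
    ∃! σ : PROFop.{u}.Sq H (PROFop.{u}.hid (Cat.of (Model T Φ))) c d, ∀ i,
      PROFop.{u}.SqEq (PROFop.{u}.sqComp σ (PROFop.{u}.hidSq ((Model.cone e).leg i)))
        (ξ.app i) := by
  obtain ⟨xleg, _, xcell, _, _, _⟩ := x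
  obtain ⟨yleg, _, ycell, _, _, _⟩ := y
  -- Once the legs are literally composites with those of the universal cone, the squares can be
  -- compared by plain equality.
  obtain rfl : (fun i => c ≫ (Model.cone e).leg i) = xleg := funext hx.leg
  obtain rfl : (fun i => d ≫ (Model.cone e).leg i) = yleg := funext hy.leg
  have hx' := (hx.cell (i := ⟨⟨⟩⟩) (j := ⟨⟨⟩⟩) (op DeltaA.one)).eq
  have hy' := (hy.cell (i := ⟨⟨⟩⟩) (j := ⟨⟨⟩⟩) (op DeltaA.one)).eq
  let θ : Square H (homProf C) (c.toFunctor ⋙ Model.forget T Φ)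
    (d.toFunctor ⋙ Model.forget T Φ) := ξ.app ⟨⟨⟩⟩
  obtain ⟨σ, hσ, hσ'⟩ := Model.existsUnique_square (c := c.toFunctor) (d := d.toFunctor) θ
    (fun {a b} h => by
      -- Only the equation at `1` is needed. Evaluated at `h`, it is the homomorphism equation for
      -- `θ(h)` with both structures transported to `F(1)`.
      have hn := ξ.naturality_hor (i := ⟨⟨⟩⟩) (j := ⟨⟨⟩⟩) (op DeltaA.one)
      dsimp only at hn hx' hy'
      rw [← hx', ← hy'] at hn
      have key : act _ (𝟙 _) (toHom (θ.app h)) ((Model.coneSquare e c).app (ofHom (𝟙 a))) =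
          act _ (toHom (θ.app h)) (𝟙 _) ((Model.coneSquare e d).app (ofHom (𝟙 b))) :=
        sqEq_app (A := A) (B := B) (A' := Cat.of C) (B' := Cat.of C)
          (F := c ≫ (Model.cone e).leg ⟨⟨⟩⟩) (G := d ≫ (Model.cone e).leg ⟨⟨⟩⟩) hn h
      rw [Model.coneSquare_app_id, Model.coneSquare_app_id] at key
      exact Metamodel.act_eq_act_of_natApp (DeltaA.isoInv_isoHom e) _ _ _ key)
  refine ⟨σ, fun i => struct_sqEq (A := A) (B := B) (A' := Cat.of C) (B' := Cat.of C)
    (F := c ≫ (Model.cone e).leg i) (G := d ≫ (Model.cone e).leg i) fun a b h => hσ h,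
    fun τ hτ => hσ' τ fun {a b} h => ?_⟩
  exact sqEq_app (A := A) (B := B) (A' := Cat.of C) (B' := Cat.of C)
    (F := c ≫ (Model.cone e).leg ⟨⟨⟩⟩) (G := d ≫ (Model.cone e).leg ⟨⟨⟩⟩) (hτ ⟨⟨⟩⟩) h

/-- The category of models is the apex of the double limit of `Φ(F)`. -/
theorem Model.isDoubleLimit_cone : (Model.cone (Φ := Φ) e).IsDoubleLimit where
  existsUnique_vert x := ⟨_, x.isFactorization_toModel e, fun _ hc =>
    VerticalDoubleCone.isFactorization_unique e hc (x.isFactorization_toModel e)⟩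
  existsUnique_sq _ _ _ ξ _ _ hx hy := Model.existsUnique_sq e ξ hx hy

end

/-! ### The main theorem -/

theorem mainTheorem3 {M : Type u₁} [Category.{v₁} M] [MonoidalCategory M] (T : Mon M)
    (C : Type u) [Category.{u} C] (Φ : Metamodel M C) :
    (∃ (F : DeltaA ⥤ M) (_ : F.Monoidal), Nonempty (DeltaA.toMon F ≅ T)) ∧
    ∀ (F : DeltaA ⥤ M) [F.Monoidal] (e : DeltaA.toMon F ≅ T),
      ∃ l : VerticalDoubleCone (Φ.diagram F) (Cat.of (Model T Φ)),
        (∀ i, l.leg i = (Model.forget T Φ).toCatHom) ∧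
        (∀ i j, PROFop.SqEq (l.cell (i := i) (j := j) (op DeltaA.one))
          (Model.squareComp T Φ e.hom.hom)) ∧
        l.IsDoubleLimit := by
  refine ⟨⟨TensorPower.functor T.X, inferInstance, ⟨TensorPower.toMonFunctorIso T⟩⟩,
    fun F _ e => ⟨Model.cone e, fun _ => rfl, fun i j => ?_, Model.isDoubleLimit_cone e⟩⟩
  -- The only map `1 ⟶ 1` is the identity, so the morphism from `F(1)` to `T` used at `1` is the
  -- given isomorphism itself.
  exact .of_eq (congrArg (Model.squareComp T Φ) (DeltaA.fromOne_one (DeltaA.isoHom e)))
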